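/- Let $F$ be a field of characteristic zero and let $\mathcal{U}=UT_3(F)$ be the algebra of upper triangular $3\times 3$ matrices over $F$, with the elementary $\mathbb{Z}_2$-grading induced by $(0,1,0)$ (so $e_{11},e_{22},e_{33},e_{13}$ have degree $0$ and $e_{12},e_{23}$ have degree $1$) and the reflection involution $e_{ij}^{*}=e_{4-j,4-i}$, which is a graded involution. Let $F_{\mathbb{Z}_2,*}\langle X\rangle$ be the free $\mathbb{Z}_2$-graded algebra with graded involution on the variables $x_{i,g}$, $g\in\mathbb{Z}_2$, and write $y_i^{\pm}=x_{i,0}\pm x_{i,0}^{*}$, $z_i^{\pm}=x_{i,1}\pm x_{i,1}^{*}$. Let $T$ be the ideal of $(\mathbb{Z}_2,*)$-identities of $\mathcal{U}$, let $P_n$ be the span of the monomials $x_{\sigma(1),g_1}^{\delta_1}\cdots x_{\sigma(n),g_n}^{\delta_n}$ with $\sigma\in S_n$, $g_k\in\mathbb{Z}_2$, $\delta_k\in\{\emptyset,*\}$, and let $\Gamma$ be the span of the $Y^+$-proper polynomials, that is, of the products of powers of the $y_i^-$, of the $z_i^+$ and of the $z_i^-$ (in this order) followed by a product of left-normed commutators,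 of length at least two, of the variables $y_i^{\pm},z_i^{\pm}$. Let $$c_n=\dim P_n/(P_n\cap T),\qquad \gamma_n=\dim \Gamma_n/(\Gamma_n\cap T),\quad \Gamma_n=\Gamma\cap P_n,$$ be the codimensions and the $Y^+$-proper codimensions of $\mathcal{U}$. Then: 1. $\gamma_n=1+n+2n(2^n-1)+\binom n2 2^n$ for every $n\ge 0$ with $n\neq 1$, and $\gamma_1=3$; 2. $c_n=\sum_{i=0}^n\binom ni\gamma_i$ for every $n\ge 0$; 3. $3^n\le c_n\le\left(1+2n+\binom n2\right)3^n$ for every $n\ge 0$; 4. the limit $\exp^{\mathbb{Z}_2,*}(\mathcal{U})=\lim_{n\to\infty}\sqrt[n]{c_n}$ exists and equals $3$. -/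

import Mathlib

open Filter Topology

noncomputable section

namespace UTStar

/-! ### Graded algebras with graded involution, identities and codimensions -/

section General

variable {F : Type*} [Field F] {G : Type*} [AddMonoid G] [DecidableEq G]
variable {A : Type*} [Ring A] [Algebra F A]

/-- A graded involution on the `G`-graded algebra `A = ⊕ 𝒜 g`: an `F`-linear map of order two
which reverses products and preserves every homogeneous component. -/
structure GradedInvolution (𝒜 : G → Submodule F A) [GradedAlgebra 𝒜] extends A →ₗ[F] A where
  involutive' : ∀ a, toFun (toFun a) = a
  map_mul_rev' : ∀ a b, toFun (a * b) = toFun b * toFun a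
  map_mem' : ∀ d, ∀ a ∈ 𝒜 d, toFun a ∈ 𝒜 d

variable (F G) in
/-- The free `G`-graded algebra with graded involution. It is the free algebra on the letters
`(i, g, false)`, which stands for `x_{i,g}`, and `(i, g, true)`, which stands for `x_{i,g}^*`. -/
abbrev FreeStar : Type _ := FreeAlgebra F (ℕ × G × Bool)

/-- The letter `x_{i,g}` (for `δ = false`) or `x_{i,g}^*` (for `δ = true`). -/
def X (F : Type*) [Field F] {G : Type*} (i : ℕ) (g : G) (δ : Bool) : FreeStar F G :=
  FreeAlgebra.ι F (i, g, δ)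

/-- Evaluation at a substitution: `x_{i,g} ↦ a i g` and `x_{i,g}^* ↦ (a i g)^*`. -/
def eval {𝒜 : G → Submodule F A} [GradedAlgebra 𝒜] (s : GradedInvolution 𝒜) (a : ℕ → G → A) :
    FreeStar F G →ₐ[F] A :=
  FreeAlgebra.lift F fun v => if v.2.2 then s.toLinearMap (a v.1 v.2.1) else a v.1 v.2.1

/-- The `(G, *)`-identities of `A`: the polynomials that vanish under every substitution of
elements of `𝒜 g` for the variables `x_{i,g}`. -/
def identities {𝒜 : G → Submodule F A} [GradedAlgebra 𝒜] (s : GradedInvolution 𝒜) :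
    Submodule F (FreeStar F G) where
  carrier := {f | ∀ a : ℕ → G → A, (∀ i g, a i g ∈ 𝒜 g) → eval s a f = 0}
  zero_mem' := fun a _ => map_zero _
  add_mem' := fun hf hf' a ha => by rw [map_add, hf a ha, hf' a ha, add_zero]
  smul_mem' := fun c f hf a ha => by rw [map_smul, hf a ha, smul_zero]

variable (F G) in
/-- The multilinear polynomials of degree `n`: the span of all the monomials
`x_{σ(1),g_1}^{δ_1} ⋯ x_{σ(n),g_n}^{δ_n}` (the indices run over `0, …, n - 1`). -/
def multilinear (n : ℕ) : Submodule F (FreeStar F G) :=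
  Submodule.span F (Set.range fun t : Equiv.Perm (Fin n) × (Fin n → G) × (Fin n → Bool) =>
    (List.ofFn fun k => X F (t.1 k : ℕ) (t.2.1 k) (t.2.2 k)).prod)

/-- The dimension of `V / (V ∩ T)`, where `T` is the space of `(G, *)`-identities of `A`. -/
def dimModIdentities {𝒜 : G → Submodule F A} [GradedAlgebra 𝒜] (s : GradedInvolution 𝒜)
    (V : Submodule F (FreeStar F G)) : ℕ :=
  Module.finrank F (V ⧸ (identities s).submoduleOf V)

/-- The `n`-th `(G, *)`-codimension of `A`. -/
def codim {𝒜 : G → Submodule F A} [GradedAlgebra 𝒜] (s : GradedInvolution 𝒜) (n : ℕ) : ℕ :=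
  dimModIdentities s (multilinear F G n)

/-- `A` has `(G, *)`-exponent `e`: the limit of the `n`-th roots of the `(G, *)`-codimensions
exists and equals `e`. -/
def HasExponent {𝒜 : G → Submodule F A} [GradedAlgebra 𝒜] (s : GradedInvolution 𝒜)
    (e : ℝ) : Prop :=
  Tendsto (fun n : ℕ => (codim s n : ℝ) ^ ((1 : ℝ) / (n : ℝ))) atTop (𝓝 e)

end General

/-! ### Proper polynomials, for gradings by `ℤ/2`

In characteristic different from two the free algebra with involution on the `x_{i,0}`, `x_{i,1}`
is also freely generated, as an algebra, by the symmetric elements `y_i^+`, `z_i^+` and the skew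
elements `y_i^-`, `z_i^-` below. -/

section Proper

variable (F : Type*) [Field F]

/-- The symmetric even variable `y_i^+`. -/
def yPlus (i : ℕ) : FreeStar F (ZMod 2) := X F i 0 false + X F i 0 true

/-- The skew-symmetric even variable `y_i^-`. -/
def yMinus (i : ℕ) : FreeStar F (ZMod 2) := X F i 0 false - X F i 0 true

/-- The symmetric odd variable `z_i^+`. -/
def zPlus (i : ℕ) : FreeStar F (ZMod 2) := X F i 1 false + X F i 1 true

/-- The skew-symmetric odd variable `z_i^-`. -/
def zMinus (i : ℕ) : FreeStar F (ZMod 2) := X F i 1 false - X F i 1 true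

/-- The set `Y ∪ Z` of all symmetric and skew-symmetric homogeneous variables. -/
def letters : Set (FreeStar F (ZMod 2)) :=
  Set.range (yPlus F) ∪ Set.range (yMinus F) ∪ Set.range (zPlus F) ∪ Set.range (zMinus F)

/-- The left-normed commutators `[a, b, l_1, …, l_k]`, `k ≥ 0`, of elements of `Y ∪ Z`. -/
def commutators : Set (FreeStar F (ZMod 2)) :=
  {u | ∃ a ∈ letters F, ∃ b ∈ letters F, ∃ l : List (FreeStar F (ZMod 2)),
    (∀ v ∈ l, v ∈ letters F) ∧ u = l.foldl (fun w v => w * v - v * w) (a * b - b * a)}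

/-- The ordered product `(v 0)^{q 0} ⋯ (v (b - 1))^{q (b - 1)}`. -/
def orderedProd (v : ℕ → FreeStar F (ZMod 2)) (b : ℕ) (q : ℕ → ℕ) : FreeStar F (ZMod 2) :=
  ((List.range b).map fun i => v i ^ q i).prod

/-- The space `Γ` of `Y⁺`-proper polynomials: the span of the products of powers of the `y_i^-`,
the `z_i^+` and the `z_i^-`, in this order, followed by a product of commutators. -/
def proper : Submodule F (FreeStar F (ZMod 2)) :=
  Submodule.span F {f | ∃ (b c d : ℕ) (q r t : ℕ → ℕ) (us : List (FreeStar F (ZMod 2))),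
    (∀ u ∈ us, u ∈ commutators F) ∧
    f = orderedProd F (yMinus F) b q * orderedProd F (zPlus F) c r *
      orderedProd F (zMinus F) d t * us.prod}

variable {F}

/-- The `n`-th `Y⁺`-proper codimension: the dimension of `Γ_n / (Γ_n ∩ T)`, where
`Γ_n = Γ ∩ P_n`. -/
def properCodim {A : Type*} [Ring A] [Algebra F A] {𝒜 : ZMod 2 → Submodule F A}
    [GradedAlgebra 𝒜] (s : GradedInvolution 𝒜) (n : ℕ) : ℕ :=
  dimModIdentities s (proper F ⊓ multilinear F (ZMod 2) n)

end Proper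

/-! ### Upper triangular matrices -/

section UpperTriangular

variable (F : Type*) [Field F] (m : ℕ)

/-- The algebra of upper triangular `m × m` matrices. -/
def UT : Subalgebra F (Matrix (Fin m) (Fin m) F) where
  carrier := {M | ∀ i j, j < i → M i j = 0}
  mul_mem' := fun {M N} hM hN i j hij => by
    rw [Matrix.mul_apply]
    refine Finset.sum_eq_zero fun k _ => ?_
    rcases lt_or_ge k i with h | h
    · rw [hM i k h, zero_mul]
    · rw [hN k j (lt_of_lt_of_le hij h), mul_zero]
  add_mem' := fun {M N} hM hN i j hij => by
    rw [Matrix.add_apply, hM i j hij, hN i j hij, add_zero]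
  algebraMap_mem' := fun c i j hij => by
    rw [Matrix.algebraMap_matrix_apply, if_neg hij.ne']

variable {G : Type*} [AddGroup G] [DecidableEq G] (g : Fin m → G)

/-- The elementary grading induced by `g`: the component of degree `d` consists of the matrices
supported on the positions `(i, j)` with `g i - g j = d`. -/
def elementaryGrading (d : G) : Submodule F (UT F m) where
  carrier := {M | ∀ i j, g i - g j ≠ d → M.1 i j = 0}
  zero_mem' := fun _ _ _ => rfl
  add_mem' := fun {M N} hM hN i j hij => by
    change M.1 i j + N.1 i j = 0
    rw [hM i j hij, hN i j hij, add_zero]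
  smul_mem' := fun c M hM i j hij => by
    change c • M.1 i j = 0
    rw [hM i j hij, smul_zero]

/-- The homogeneous part of degree `d` of an upper triangular matrix. -/
def homogeneousPart (d : G) : UT F m →ₗ[F] elementaryGrading F m g d where
  toFun M := ⟨⟨fun i j => if g i - g j = d then M.1 i j else 0, fun i j hij => by
      change (if g i - g j = d then M.1 i j else 0) = 0
      rw [M.2 i j hij, ite_self]⟩, fun i j hij => if_neg hij⟩
  map_add' M N := by
    ext i j
    change (if g i - g j = d then M.1 i j + N.1 i j else 0) =
      (if g i - g j = d then M.1 i j else 0) + (if g i - g j = d then N.1 i j else 0)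
    split_ifs <;> simp
  map_smul' c M := by
    ext i j
    change (if g i - g j = d then c • M.1 i j else 0) =
      c • (if g i - g j = d then M.1 i j else 0)
    split_ifs <;> simp

theorem homogeneousPart_of_mem {d e : G} (x : elementaryGrading F m g e) :
    (homogeneousPart F m g d x : UT F m) = if d = e then (x : UT F m) else 0 := by
  ext i j
  change (if g i - g j = d then x.1.1 i j else 0) = _
  by_cases hde : d = e
  · subst hde
    rw [if_pos rfl]
    split_ifs with h
    · rfl
    · exact (x.2 i j h).symm
  · rw [if_neg hde]
    split_ifs with h
    · exact x.2 i j fun h' => hde (h.symm.trans h')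
    · rfl

theorem homogeneousPart_coe (d : G) (y : DirectSum G fun e => elementaryGrading F m g e) :
    homogeneousPart F m g d (DirectSum.coeAddMonoidHom (elementaryGrading F m g) y) = y d := by
  induction y using DirectSum.induction_on with
  | zero => simp
  | of e x =>
    apply Subtype.ext
    rw [DirectSum.coeAddMonoidHom_of, homogeneousPart_of_mem]
    by_cases hde : d = e
    · subst hde
      rw [if_pos rfl, DirectSum.of_eq_same]
    · rw [if_neg hde, DirectSum.of_eq_of_ne _ _ _ hde]
      rfl
  | add x y hx hy => rw [map_add, map_add, hx, hy, DirectSum.add_apply]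

/-- The elementary grading is a grading of the algebra of upper triangular matrices. -/
instance elementaryGradedAlgebra : GradedAlgebra (elementaryGrading F m g) where
  one_mem := fun i j hij => by
    change (1 : Matrix (Fin m) (Fin m) F) i j = 0
    refine Matrix.one_apply_ne fun h => hij ?_
    rw [h, sub_self]
  mul_mem := fun d e M N hM hN i j hij => by
    change (M.1 * N.1) i j = 0
    rw [Matrix.mul_apply]
    refine Finset.sum_eq_zero fun k _ => ?_
    by_cases h : g i - g k = d
    · rw [hN k j, mul_zero]
      intro h'
      exact hij (by rw [← h, ← h', sub_add_sub_cancel])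
    · rw [hM i k h, zero_mul]
  decompose' := fun M => DirectSum.mk (fun d => elementaryGrading F m g d)
    (Finset.univ.image fun p : Fin m × Fin m => g p.1 - g p.2)
    fun d => homogeneousPart F m g d M
  left_inv := fun M => by
    set S := Finset.univ.image fun p : Fin m × Fin m => g p.1 - g p.2 with hS
    have h1 : DirectSum.coeAddMonoidHom (elementaryGrading F m g)
        (DirectSum.mk (fun d => elementaryGrading F m g d) S
          fun d => homogeneousPart F m g d M) =
        ∑ d ∈ S, (homogeneousPart F m g d M : UT F m) := by
      have h2 : DirectSum.mk (fun d => elementaryGrading F m g d) S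
          (fun d => homogeneousPart F m g d M) =
          ∑ d ∈ S, DirectSum.of (fun d => elementaryGrading F m g d) d
            (homogeneousPart F m g d M) := by
        refine DFinsupp.ext fun e => ?_
        rw [DirectSum.sum_apply]
        by_cases he : e ∈ S
        · refine (DirectSum.mk_apply_of_mem he).trans ?_
          rw [Finset.sum_eq_single_of_mem e he fun d _ hd =>
            DirectSum.of_eq_of_ne _ _ _ hd.symm]
          rw [DirectSum.of_eq_same]
        · refine (DirectSum.mk_apply_of_notMem he).trans (Finset.sum_eq_zero fun d hd => ?_).symm
          exact DirectSum.of_eq_of_ne (β := fun d => elementaryGrading F m g d) _ _ _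
            fun h => he (h ▸ hd)
      rw [h2, map_sum]
      exact Finset.sum_congr rfl fun d _ => DirectSum.coeAddMonoidHom_of _ _ _
    rw [h1]
    ext i j
    rw [AddSubmonoidClass.coe_finsetSum, Matrix.sum_apply]
    have hmem : g i - g j ∈ S :=
      Finset.mem_image.mpr ⟨(i, j), Finset.mem_univ _, rfl⟩
    exact (Finset.sum_eq_single_of_mem _ hmem fun d _ hd => if_neg hd.symm).trans (if_pos rfl)
  right_inv := fun y => by
    refine DFinsupp.ext fun d => ?_
    set S := Finset.univ.image fun p : Fin m × Fin m => g p.1 - g p.2 with hS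
    by_cases hd : d ∈ S
    · exact (DirectSum.mk_apply_of_mem hd).trans (homogeneousPart_coe F m g d y)
    · refine (DirectSum.mk_apply_of_notMem hd).trans ?_
      ext i j
      refine ((y d).2 i j fun h => hd ?_).symm
      exact Finset.mem_image.mpr ⟨(i, j), Finset.mem_univ _, h⟩

/-- The reflection `e_{ij}^* = e_{m+1-j, m+1-i}`, as a graded involution for an elementary grading
in which `e_{ij}` and `e_{ij}^*` always have the same degree. -/
def reflection (hg : ∀ i j : Fin m, g j.rev - g i.rev = g i - g j) :
    GradedInvolution (elementaryGrading F m g) where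
  toFun M := ⟨fun i j => M.1 j.rev i.rev, fun i j hij => M.2 _ _ (Fin.rev_lt_rev.mpr hij)⟩
  map_add' _ _ := rfl
  map_smul' _ _ := rfl
  involutive' M := by
    ext i j
    change M.1 i.rev.rev j.rev.rev = M.1 i j
    rw [Fin.rev_rev, Fin.rev_rev]
  map_mul_rev' M N := by
    ext i j
    change (M.1 * N.1) j.rev i.rev = ∑ k : Fin m, N.1 k.rev i.rev * M.1 j.rev k.rev
    rw [Matrix.mul_apply, ← Equiv.sum_comp Fin.revPerm]
    exact Finset.sum_congr rfl fun k _ => mul_comm _ _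
  map_mem' d M hM i j hij := hM _ _ (by rwa [hg])

end UpperTriangular

/-- The reflection involution on `UT_3(F)` with the elementary `ℤ/2`-grading induced by
`(0, 1, 0)`. -/
def reflection3 (F : Type*) [Field F] :
    GradedInvolution (elementaryGrading F 3 (![0, 1, 0] : Fin 3 → ZMod 2)) :=
  reflection F 3 ![0, 1, 0] (by decide)

end UTStar

end

noncomputable section

namespace UTStar

/-! ### A homogeneous basis of `UT₃` adapted to the involution -/

/-! Substituting half of a homogeneous symmetric or skew basis element b for x_i sends the letter
y_i^± or z_i^± of the kind of b to b and the other letters of index i to 0. By multilinearity, an f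
in P_n is an identity iff all matrix entries of its values at sequences of basis elements vanish.
The proof finds a basis for the span of these entry functionals.

Spanning (`mem_identities_of_good`). The weight of the sequence decides which superdiagonal can be
nonzero. In weight 0 everything reduces to entry (0,0), where `h` acts like `one`. In weight 1 both
(0,1) and (1,2) are needed, but without a `d` they are proportional, by a factor independent of the
order of multiplication. In weight 2, entry (0,2) comes either from two odd elements or from one
`c`. In the latter case `h` again acts like `one`, and without a `d` the functional coincides with a
diagonal one. The functionals that remain are those of `Slot`.

Independence (`exists_dual`). Each remaining functional has a polynomial on which it does not
vanish: a proper polynomial in the letters at the positions other than `one`, times the y_i^+ at the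
positions of `one`. A word vanishes at sequences of other kinds, and a proper factor vanishes as
soon as one of its variables becomes `one`, because proper polynomials ignore scalar shifts of the
y_i^+. Ordering the functionals by the number of `one`s, with `lower` after `upper`, makes the
system triangular, so the dimension is the number of functionals.

Counting. On Γ_n exactly the functionals without `one` survive. For s positions other than `one` the
five slots give 1, s (0 if s = 1), s 2^s, s(2^s - 2) and binom(s,2) 2^s. Choosing the positions
other than `one` yields the binomial formula for c_n, and the bounds follow from the sum of
binom(n,i) 2^i being 3^n. -/

/-- Labels of a basis of `UT₃`: the identity, `e₁₁ - e₂₂ + e₃₃`, `e₁₃`, `e₁₁ - e₃₃`,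
`e₁₂ + e₂₃` and `e₁₂ - e₂₃`. -/
inductive Bas
  | one | h | c | d | p | m
  deriving DecidableEq

namespace Bas

instance : Fintype Bas := ⟨{one, h, c, d, p, m}, fun b => by cases b <;> decide⟩

/-- The degree of a basis element. -/
def deg : Bas → ZMod 2
  | one | h | c | d => 0
  | p | m => 1

/-- Whether a basis element is skew. -/
def skew : Bas → Bool
  | one | h | c | p => false
  | d | m => true

/-- Degree and symmetry of a basis element. -/
def kind (b : Bas) : ZMod 2 × Bool := (b.deg, b.skew)

variable (F : Type*) [Field F]

/-- The matrix of a basis element. -/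
def mat : Bas → Matrix (Fin 3) (Fin 3) F
  | one => 1
  | h => Matrix.diagonal ![1, -1, 1]
  | c => !![0, 0, 1; 0, 0, 0; 0, 0, 0]
  | d => Matrix.diagonal ![1, 0, -1]
  | p => !![0, 1, 0; 0, 0, 1; 0, 0, 0]
  | m => !![0, 1, 0; 0, 0, -1; 0, 0, 0]

theorem mat_mem (b : Bas) : b.mat F ∈ UT F 3 := by
  intro i j hij
  cases b <;> fin_cases i <;> fin_cases j <;> simp [mat] at hij ⊢

/-- The basis element as an upper triangular matrix. -/
def elt (b : Bas) : UT F 3 := ⟨b.mat F, b.mat_mem F⟩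

/-- The sign of a basis element under the involution. -/
def sign (b : Bas) : F := if b.skew then -1 else 1

theorem star_elt (b : Bas) : (reflection3 F).toLinearMap (b.elt F) = b.sign F • b.elt F := by
  apply Subtype.ext
  ext i j
  change b.mat F j.rev i.rev = b.sign F * b.mat F i j
  cases b <;> fin_cases i <;> fin_cases j <;> simp [mat, sign, skew, Fin.rev]

theorem elt_mem (b : Bas) :
    b.elt F ∈ elementaryGrading F 3 (![0, 1, 0] : Fin 3 → ZMod 2) b.deg := by
  intro i j hij
  change b.mat F i j = 0
  revert hij
  cases b <;> fin_cases i <;> fin_cases j <;> simp [mat, deg]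

end Bas

open Bas

variable {F : Type*} [Field F]

/-- The element of degree `g` with given coordinates in the adapted basis, halved. -/
def halfSum (F : Type*) [Field F] (g : ZMod 2) : (Bas → F) →ₗ[F] UT F 3 :=
  ∑ b : Bas, if b.deg = g then
    (LinearMap.proj b : (Bas → F) →ₗ[F] F).smulRight ((1 / 2 : F) • b.elt F) else 0

theorem halfSum_apply (g : ZMod 2) (v : Bas → F) :
    halfSum F g v = ∑ b : Bas, if b.deg = g then v b • (1 / 2 : F) • b.elt F else 0 := by
  rw [halfSum, LinearMap.sum_apply]
  refine Finset.sum_congr rfl fun b _ => ?_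
  split_ifs <;> rfl

theorem halfSum_single (g : ZMod 2) (b : Bas) :
    halfSum F g (Pi.single b 1) = if b.deg = g then (1 / 2 : F) • b.elt F else 0 := by
  rw [halfSum_apply, Finset.sum_eq_single b]
  · simp
  · intro b' _ hb
    simp [Pi.single_eq_of_ne hb]
  · simp

theorem sum_bas {M : Type*} [AddCommMonoid M] (f : Bas → M) :
    ∑ b, f b = f one + f h + f c + f d + f p + f m := by
  have : (Finset.univ : Finset Bas) = {one, h, c, d, p, m} := rfl
  rw [this]
  simp [add_assoc]

theorem zmod_two_cases (g : ZMod 2) : g = 0 ∨ g = 1 := by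
  revert g; decide

theorem halfSum_entry (g : ZMod 2) (v : Bas → F) (i j : Fin 3) :
    (halfSum F g v).1 i j =
      ∑ b : Bas, if b.deg = g then v b * (1 / 2 * b.mat F i j) else 0 := by
  rw [halfSum_apply, AddSubmonoidClass.coe_finsetSum, Matrix.sum_apply]
  refine Finset.sum_congr rfl fun b _ => ?_
  split_ifs <;> rfl

theorem exists_halfSum [CharZero F] {g : ZMod 2} {M : UT F 3}
    (hM : M ∈ elementaryGrading F 3 (![0, 1, 0] : Fin 3 → ZMod 2) g) :
    ∃ v : Bas → F, ∀ g', halfSum F g' v = if g' = g then M else 0 := by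
  have hut := M.2
  rcases zmod_two_cases g with rfl | rfl
  -- These are the coordinates of twice `M`, since `halfSum` halves. A diagonal (t, u, t) is (t+u)/2
  -- times `one` plus (t-u)/2 times `h`, and the skew rest is a multiple of `d`.
  · refine ⟨fun b => match b with
      | one => (M.1 0 0 + M.1 2 2) / 2 + M.1 1 1
      | h => (M.1 0 0 + M.1 2 2) / 2 - M.1 1 1
      | c => 2 * M.1 0 2
      | d => M.1 0 0 - M.1 2 2
      | p => 0
      | m => 0, fun g' => ?_⟩
    rcases zmod_two_cases g' with rfl | rfl
    · apply Subtype.ext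
      ext i j
      rw [halfSum_entry, sum_bas]
      simp only [deg, if_true, one_ne_zero, if_false, add_zero]
      have h01 := hM 0 1 (by decide)
      have h12 := hM 1 2 (by decide)
      have h10 := hut 1 0 (by decide)
      have h20 := hut 2 0 (by decide)
      have h21 := hut 2 1 (by decide)
      fin_cases i <;> fin_cases j <;> simp [mat, h01, h12, h10, h20, h21] <;> ring
    · rw [halfSum_apply, sum_bas]
      simp [deg]
  · refine ⟨fun b => match b with
      | one => 0
      | h => 0
      | c => 0
      | d => 0
      | p => M.1 0 1 + M.1 1 2
      | m => M.1 0 1 - M.1 1 2, fun g' => ?_⟩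
    rcases zmod_two_cases g' with rfl | rfl
    · rw [halfSum_apply, sum_bas]
      simp [deg]
    · apply Subtype.ext
      ext i j
      rw [halfSum_entry, sum_bas]
      simp only [deg, if_true, zero_ne_one, if_false, zero_add]
      have h00 := hM 0 0 (by decide)
      have h11 := hM 1 1 (by decide)
      have h22 := hM 2 2 (by decide)
      have h02 := hM 0 2 (by decide)
      have h10 := hut 1 0 (by decide)
      have h20 := hut 2 0 (by decide)
      have h21 := hut 2 1 (by decide)
      fin_cases i <;> fin_cases j <;> simp [mat, h00, h11, h22, h02, h10, h20, h21] <;> ring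

/-! ### Evaluation at basis elements -/

/-- The substitution of halved basis elements for the variables. -/
def basSubst (F : Type*) [Field F] (β : ℕ → Bas) (i : ℕ) (g : ZMod 2) : UT F 3 :=
  if (β i).deg = g then (1 / 2 : F) • (β i).elt F else 0

theorem basSubst_mem (β : ℕ → Bas) (i : ℕ) (g : ZMod 2) :
    basSubst F β i g ∈ elementaryGrading F 3 (![0, 1, 0] : Fin 3 → ZMod 2) g := by
  rw [basSubst]
  split_ifs with hg
  · exact hg ▸ Submodule.smul_mem _ _ ((β i).elt_mem F)
  · exact Submodule.zero_mem _

/-- Evaluation at halved basis elements, with values in matrices. -/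
def evM (F : Type*) [Field F] (β : ℕ → Bas) :
    FreeStar F (ZMod 2) →ₐ[F] Matrix (Fin 3) (Fin 3) F :=
  (UT F 3).val.comp (eval (reflection3 F) (basSubst F β))

theorem evM_eq_zero_iff (β : ℕ → Bas) (f : FreeStar F (ZMod 2)) :
    evM F β f = 0 ↔ eval (reflection3 F) (basSubst F β) f = 0 :=
  ZeroMemClass.coe_eq_zero

theorem evM_eq_zero_of_mem {f : FreeStar F (ZMod 2)} (hf : f ∈ identities (reflection3 F))
    (β : ℕ → Bas) : evM F β f = 0 :=
  (evM_eq_zero_iff β f).2 (hf _ (basSubst_mem β))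

theorem evM_apply_of_lt (β : ℕ → Bas) (f : FreeStar F (ZMod 2)) {i j : Fin 3} (hij : j < i) :
    evM F β f i j = 0 :=
  (eval (reflection3 F) (basSubst F β) f).2 i j hij

theorem eval_X (a : ℕ → ZMod 2 → UT F 3) (i : ℕ) (g : ZMod 2) (δ : Bool) :
    eval (reflection3 F) a (X F i g δ) =
      if δ then (reflection3 F).toLinearMap (a i g) else a i g :=
  FreeAlgebra.lift_ι_apply _ _

theorem evM_X (β : ℕ → Bas) (i : ℕ) (g : ZMod 2) (δ : Bool) :
    evM F β (X F i g δ) = (if (β i).deg = g then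
      (if δ then (β i).sign F else 1) * (1 / 2) else 0) • (β i).mat F := by
  change (eval (reflection3 F) (basSubst F β) (X F i g δ)).1 = _
  rw [eval_X, basSubst]
  by_cases hg : (β i).deg = g
  · rw [if_pos hg, if_pos hg]
    cases δ
    · simp [elt]
    · simp only [if_true]
      rw [map_smul, star_elt, smul_smul, mul_comm]
      rfl
  · rw [if_neg hg, if_neg hg]
    cases δ <;> simp

/-- The letter of given degree and symmetry: one of `y_i^±`, `z_i^±`. -/
def letter (F : Type*) [Field F] (k : ZMod 2 × Bool) (i : ℕ) : FreeStar F (ZMod 2) :=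
  X F i k.1 false + (if k.2 then -1 else 1 : F) • X F i k.1 true

theorem yPlus_eq (i : ℕ) : yPlus F i = letter F (0, false) i := by simp [yPlus, letter]
theorem yMinus_eq (i : ℕ) : yMinus F i = letter F (0, true) i := by
  simp [yMinus, letter, sub_eq_add_neg]
theorem zPlus_eq (i : ℕ) : zPlus F i = letter F (1, false) i := by simp [zPlus, letter]
theorem zMinus_eq (i : ℕ) : zMinus F i = letter F (1, true) i := by
  simp [zMinus, letter, sub_eq_add_neg]

theorem letter_mem_letters (k : ZMod 2 × Bool) (i : ℕ) : letter F k i ∈ letters F := by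
  obtain ⟨g, δ⟩ := k
  rcases zmod_two_cases g with rfl | rfl <;> cases δ
  · exact .inl (.inl (.inl ⟨i, yPlus_eq i⟩))
  · exact .inl (.inl (.inr ⟨i, yMinus_eq i⟩))
  · exact .inl (.inr ⟨i, zPlus_eq i⟩)
  · exact .inr ⟨i, zMinus_eq i⟩

/-- The two summands of the letter are halves that add up when the symmetry agrees and cancel when
it does not; this is the reason for the factor 1/2. -/
theorem evM_letter [CharZero F] (β : ℕ → Bas) (k : ZMod 2 × Bool) (i : ℕ) :
    evM F β (letter F k i) = if (β i).kind = k then (β i).mat F else 0 := by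
  obtain ⟨g, δ⟩ := k
  rw [letter, map_add, map_smul, evM_X, evM_X, smul_smul, ← add_smul]
  by_cases hg : (β i).deg = g
  · simp only [hg, if_true, kind, Prod.mk.injEq, true_and, sign]
    cases hs : (β i).skew <;> cases δ <;> norm_num
  · simp [hg, kind]

/-! ### Multilinear polynomials -/

/-- A multilinear polynomial evaluates to a multilinear function of the coordinates. -/
theorem exists_multilinearMap {n : ℕ} {f : FreeStar F (ZMod 2)}
    (hf : f ∈ multilinear F (ZMod 2) n) :
    ∃ L : MultilinearMap F (fun _ : Fin n => Bas → F) (UT F 3),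
      ∀ (a : ℕ → ZMod 2 → UT F 3) (v : Fin n → Bas → F),
        (∀ (i : Fin n) g, a i g = halfSum F g (v i)) → eval (reflection3 F) a f = L v := by
  induction hf using Submodule.span_induction with
  | mem f hf =>
    obtain ⟨⟨σ, g, δ⟩, rfl⟩ := hf
    refine ⟨((MultilinearMap.mkPiAlgebraFin F n (UT F 3)).compLinearMap fun k =>
      (if δ k then (reflection3 F).toLinearMap else LinearMap.id) ∘ₗ
        halfSum F (g k)).domDomCongr σ, fun a v hav => ?_⟩
    rw [map_list_prod, List.map_ofFn, MultilinearMap.domDomCongr_apply,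
      MultilinearMap.compLinearMap_apply, MultilinearMap.mkPiAlgebraFin_apply]
    congr 2
    funext k
    rw [Function.comp_apply, eval_X, hav]
    dsimp only
    rw [LinearMap.comp_apply]
    split_ifs <;> rfl
  | zero => exact ⟨0, fun a v _ => by simp⟩
  | add f₁ f₂ _ _ h₁ h₂ =>
    obtain ⟨L₁, h₁⟩ := h₁
    obtain ⟨L₂, h₂⟩ := h₂
    exact ⟨L₁ + L₂, fun a v hav => by
      rw [map_add, h₁ a v hav, h₂ a v hav, add_apply]⟩
  | smul c f _ h =>
    obtain ⟨L, h⟩ := h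
    exact ⟨c • L, fun a v hav => by rw [map_smul, h a v hav, smul_apply]⟩

/-- Extension of a finite sequence of basis elements by `one`. -/
def extend {n : ℕ} (β : Fin n → Bas) (i : ℕ) : Bas := if hi : i < n then β ⟨i, hi⟩ else one

@[simp]
theorem extend_coe {n : ℕ} (β : Fin n → Bas) (i : Fin n) : extend β i = β i := dif_pos i.2

/-- A multilinear polynomial which vanishes at all basis elements is an identity. -/
theorem mem_identities_of_evM [CharZero F] {n : ℕ} {f : FreeStar F (ZMod 2)}
    (hf : f ∈ multilinear F (ZMod 2) n) (h : ∀ β : Fin n → Bas, evM F (extend β) f = 0) :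
    f ∈ identities (reflection3 F) := by
  intro a ha
  obtain ⟨L, hL⟩ := exists_multilinearMap hf
  choose v hv using fun i g => exists_halfSum (ha i g)
  -- One coordinate vector serves both degrees, because `v i g` contributes nothing to `halfSum` in
  -- the other degree.
  rw [hL a (fun i => v i 0 + v i 1)]
  · have hL0 : L = 0 := by
      refine Module.Basis.ext_multilinear (fun _ => Pi.basisFun F Bas) fun β => ?_
      have := hL (basSubst F (extend β)) (fun i => Pi.single (β i) 1) fun i g => by
        rw [halfSum_single, basSubst, extend_coe]
      rw [(evM_eq_zero_iff _ _).1 (h β)] at this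
      simpa [Pi.basisFun_apply] using this.symm
    rw [hL0, zero_apply]
  · intro i g
    rw [map_add, hv, hv]
    rcases zmod_two_cases g with rfl | rfl <;> simp

/-- Linear relations between values of multilinear polynomials need only be checked on products
of basis elements. -/
theorem evM_relation {n : ℕ} {β β' : Fin n → Bas} (hk : ∀ i, (β i).kind = (β' i).kind)
    {i j i' j' : Fin 3} {r : F}
    (h : ∀ σ : Equiv.Perm (Fin n), ((List.ofFn (β ∘ σ)).map (mat F)).prod i j =
      r * ((List.ofFn (β' ∘ σ)).map (mat F)).prod i' j')
    {f : FreeStar F (ZMod 2)} (hf : f ∈ multilinear F (ZMod 2) n) :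
    evM F (extend β) f i j = r * evM F (extend β') f i' j' := by
  induction hf using Submodule.span_induction with
  | mem f hf =>
    obtain ⟨⟨σ, g, δ⟩, rfl⟩ := hf
    -- The scalar in front of the word involves only degrees and signs, so it is the same for `β`
    -- and `β'`, and only the bare matrix products matter.
    have key : ∀ β : Fin n → Bas,
        evM F (extend β) (List.ofFn fun k => X F (σ k : ℕ) (g k) (δ k)).prod =
        (∏ k, if (β (σ k)).deg = g k then
          (if δ k then (β (σ k)).sign F else 1) * (1 / 2) else 0) •
          ((List.ofFn (β ∘ σ)).map (mat F)).prod := by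
      intro β
      rw [map_list_prod, List.map_ofFn, List.map_ofFn]
      have : ∀ (n : ℕ) (s : Fin n → F) (M : Fin n → Matrix (Fin 3) (Fin 3) F),
          (List.ofFn fun k => s k • M k).prod = (∏ k, s k) • (List.ofFn M).prod := by
        intro n
        induction n with
        | zero => intro s M; simp
        | succ n ih =>
          intro s M
          rw [List.ofFn_succ, List.prod_cons, ih, List.ofFn_succ, List.prod_cons,
            Fin.prod_univ_succ, smul_mul_smul_comm]
      rw [← this]
      congr 2
      funext k
      simp only [Function.comp_apply]
      rw [evM_X, extend_coe]
    rw [key, key, Matrix.smul_apply, Matrix.smul_apply, h σ]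
    have : ∀ k, (β (σ k)).deg = (β' (σ k)).deg ∧ (β (σ k)).sign F = (β' (σ k)).sign F := by
      intro k
      have := hk (σ k)
      rw [kind, kind, Prod.mk.injEq] at this
      exact ⟨this.1, by rw [sign, sign, this.2]⟩
    simp only [fun k => (this k).1, fun k => (this k).2, smul_eq_mul]
    ring
  | zero => simp
  | add f₁ f₂ _ _ h₁ h₂ =>
    rw [map_add, map_add, Matrix.add_apply, Matrix.add_apply, h₁, h₂, mul_add]
  | smul c f _ h =>
    rw [map_smul, map_smul, Matrix.smul_apply, Matrix.smul_apply, h, smul_eq_mul, smul_eq_mul]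
    ring

/-! ### Products of basis elements -/

namespace Bas

/-- The distance from the diagonal of the support of a basis element. -/
def wt : Bas → ℕ
  | one | h | d => 0
  | p | m => 1
  | c => 2

/-- Replacement of `h` by `one`. -/
def clearH : Bas → Bas
  | one | h => one
  | c => c
  | d => d
  | p => p
  | m => m

/-- The factor by which multiplication by a basis element other than `d` changes the ratio of the
entries above the diagonal. -/
def ratio (F : Type*) [Field F] : Bas → F
  | one | c | d | p => 1
  | h | m => -1

theorem kind_clearH (b : Bas) : b.clearH.kind = b.kind := by cases b <;> rfl

variable {F : Type*} [Field F]

theorem mat_cons_apply (b : Bas) (M : Matrix (Fin 3) (Fin 3) F) (i j : Fin 3) :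
    (b.mat F * M) i j = b.mat F i 0 * M 0 j + b.mat F i 1 * M 1 j + b.mat F i 2 * M 2 j := by
  rw [Matrix.mul_apply, Fin.sum_univ_three]

theorem mat_ne_zero {b : Bas} {i j : Fin 3} (hb : b.mat F i j ≠ 0) :
    (i : ℕ) + b.wt = j := by
  revert hb
  cases b <;> fin_cases i <;> fin_cases j <;> simp [mat, wt]

/-- Each basis element lives on a single superdiagonal, and these distances add under
multiplication. -/
theorem prod_mat_ne_zero {l : List Bas} {i j : Fin 3} (hl : (l.map (mat F)).prod i j ≠ 0) :
    (i : ℕ) + (l.map wt).sum = j := by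
  induction l generalizing i with
  | nil =>
    rw [List.map_nil, List.prod_nil, Matrix.one_apply] at hl
    by_contra hij
    exact hl (if_neg fun h => hij (by simp [h]))
  | cons b l ih =>
    rw [List.map_cons, List.prod_cons, Matrix.mul_apply] at hl
    obtain ⟨k, -, hk⟩ := Finset.exists_ne_zero_of_sum_ne_zero hl
    have h₁ := mat_ne_zero (left_ne_zero_of_mul hk)
    have h₂ := ih (right_ne_zero_of_mul hk)
    rw [List.map_cons, List.sum_cons]
    omega

theorem prod_mat_lower (l : List Bas) {i j : Fin 3} (hij : j < i) :
    (l.map (mat F)).prod i j = 0 := by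
  by_contra h
  have := prod_mat_ne_zero h
  omega

theorem prod_mat_diag (l : List Bas) (i : Fin 3) :
    (l.map (mat F)).prod i i = (l.map fun b => b.mat F i i).prod := by
  induction l with
  | nil => simp
  | cons b l ih =>
    rw [List.map_cons, List.prod_cons, List.map_cons, List.prod_cons, mat_cons_apply, ← ih]
    have h10 := prod_mat_lower (F := F) l (i := 1) (j := 0) (by decide)
    have h20 := prod_mat_lower (F := F) l (i := 2) (j := 0) (by decide)
    have h21 := prod_mat_lower (F := F) l (i := 2) (j := 1) (by decide)
    obtain rfl | rfl | rfl : i = 0 ∨ i = 1 ∨ i = 2 := by omega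
    all_goals cases b <;> simp [mat, h10, h20, h21]

theorem prod_mat_ratio_diag {l : List Bas} (hl : d ∉ l) :
    (l.map (mat F)).prod 2 2 = (l.map (ratio F)).prod * (l.map (mat F)).prod 1 1 := by
  rw [prod_mat_diag, prod_mat_diag, ← List.prod_map_mul]
  congr 1
  refine List.map_congr_left fun b hb => ?_
  cases b
  case d => exact absurd hb hl
  all_goals simp [mat, ratio]

/-- Taking the upper left or the lower right 2×2 block is multiplicative on triangular matrices. For
every basis element except `d` the second block is `ratio` times the first; for `d` they are
diag(1,0) and diag(0,-1). -/
theorem prod_mat_ratio {l : List Bas} (hl : d ∉ l) :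
    (l.map (mat F)).prod 1 2 = (l.map (ratio F)).prod * (l.map (mat F)).prod 0 1 := by
  induction l with
  | nil => simp
  | cons b l ih =>
    rw [List.mem_cons, not_or] at hl
    have h₁ := ih hl.2
    have h₂ := prod_mat_ratio_diag (F := F) hl.2
    have h21 := prod_mat_lower (F := F) l (i := 2) (j := 1) (by decide)
    rw [List.map_cons, List.prod_cons, mat_cons_apply, mat_cons_apply, List.map_cons,
      List.prod_cons]
    cases b
    case d => exact absurd rfl hl.1
    all_goals simp [mat, ratio, h₁, h₂, h21]

/-- Weight two forces exactly one factor `c`, and all the others are the identity. -/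
theorem prod_mat_corner {l : List Bas} (hl : ∀ b ∈ l, b = one ∨ b = c)
    (hwt : (l.map wt).sum = 2) : (l.map (mat F)).prod 0 2 = 1 := by
  induction l with
  | nil => simp at hwt
  | cons b l ih =>
    rw [List.map_cons, List.sum_cons] at hwt
    have hl' := fun b hb => hl b (List.mem_cons_of_mem _ hb)
    rw [List.map_cons, List.prod_cons, mat_cons_apply]
    rcases hl b List.mem_cons_self with rfl | rfl
    · simp only [wt, zero_add] at hwt
      simp [mat, ih hl' hwt]
    · have h0 : (l.map wt).sum = 0 := by simpa [wt] using hwt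
      have : (l.map (mat F)).prod 2 2 = 1 := by
        rw [prod_mat_diag]
        refine List.prod_eq_one fun x hx => ?_
        obtain ⟨b, hb, rfl⟩ := List.mem_map.1 hx
        rcases hl' b hb with rfl | rfl
        · simp [mat]
        · have := List.sum_eq_zero_iff.1 h0 _ (List.mem_map_of_mem (f := wt) hb)
          simp [wt] at this
      simp [mat, this]

/-- Without odd factors this entry only involves rows and columns 0 and 2, where `h` and `one`
agree. -/
theorem prod_mat_clearH {l : List Bas} (hl : ∀ b ∈ l, b ≠ p ∧ b ≠ m) :
    (l.map (mat F)).prod 0 2 = ((l.map clearH).map (mat F)).prod 0 2 := by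
  induction l with
  | nil => simp
  | cons b l ih =>
    have h₁ := ih fun b hb => hl b (List.mem_cons_of_mem _ hb)
    have h₂ : (l.map (mat F)).prod 2 2 = ((l.map clearH).map (mat F)).prod 2 2 := by
      rw [prod_mat_diag, prod_mat_diag, List.map_map]
      congr 1
      refine List.map_congr_left fun b _ => ?_
      cases b <;> simp [mat, clearH]
    have h₃ := hl b List.mem_cons_self
    simp only [List.map_cons, List.prod_cons, mat_cons_apply, h₁, h₂]
    cases b
    case p => exact absurd rfl h₃.1
    case m => exact absurd rfl h₃.2
    all_goals simp [mat, clearH]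

end Bas

/-! ### A separating family of functionals -/

/-- The sequence `β` has `k` terms in `Y` and all the others are `one` or in `X`. -/
def Marked {n : ℕ} (Y X : Finset Bas) (k : ℕ) (β : Fin n → Bas) : Prop :=
  (∀ i, β i = one ∨ β i ∈ X ∨ β i ∈ Y) ∧ (Finset.univ.filter fun i => β i ∈ Y).card = k

/-- The kinds of functionals on multilinear polynomials. -/
inductive Slot
  | diag | corner | upper | lower | double
  deriving DecidableEq

namespace Slot

instance : Fintype Slot :=
  ⟨{diag, corner, upper, lower, double}, fun k => by cases k <;> decide⟩

/-- The row of the matrix entry belonging to a functional. -/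
def row : Slot → Fin 3
  | lower => 1
  | _ => 0

/-- The column of the matrix entry belonging to a functional. -/
def col : Slot → Fin 3
  | diag => 0
  | upper => 1
  | _ => 2

/-- The sequences of basis elements at which the functionals are evaluated. -/
def Good {n : ℕ} : Slot → (Fin n → Bas) → Prop
  | diag, β => Marked {c} {d} 0 β
  | corner, β => Marked {c} {d} 1 β ∧ ∃ i, β i = d
  | upper, β => Marked {p, m} {h, d} 1 β
  | lower, β => Marked {p, m} {h, d} 1 β ∧ ∃ i, β i = d
  | double, β => Marked {p, m} {h, d} 2 β

end Slot

open Slot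

variable {F : Type*} [Field F]

theorem sum_wt {n : ℕ} (β : Fin n → Bas) :
    ∑ i, (β i).wt = (Finset.univ.filter fun i => β i ∈ ({p, m} : Finset Bas)).card +
      2 * (Finset.univ.filter fun i => β i ∈ ({c} : Finset Bas)).card := by
  rw [Finset.card_filter, Finset.card_filter, Finset.mul_sum, ← Finset.sum_add_distrib]
  refine Finset.sum_congr rfl fun i _ => ?_
  cases β i <;> simp [wt]

theorem evM_eq_zero_of_wt {n : ℕ} {β : Fin n → Bas} {f : FreeStar F (ZMod 2)}
    (hf : f ∈ multilinear F (ZMod 2) n) {i j : Fin 3} (hij : (i : ℕ) + ∑ k, (β k).wt ≠ j) :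
    evM F (extend β) f i j = 0 := by
  rw [evM_relation (β' := β) (i' := i) (j' := j) (r := 0) (fun _ => rfl) (fun σ => ?_) hf,
    zero_mul]
  rw [zero_mul]
  by_contra hne
  refine hij (Eq.trans ?_ (prod_mat_ne_zero hne))
  rw [List.map_ofFn, List.sum_ofFn, ← Equiv.sum_comp σ]
  rfl

/-- Diagonal entries of triangular products are products of diagonal entries, so a relation factor
by factor multiplies up independently of the order. -/
theorem evM_diag {n : ℕ} {β β' : Fin n → Bas} (hk : ∀ i, (β i).kind = (β' i).kind)
    {i j : Fin 3} {r : Bas → F}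
    (h : ∀ k, (β k).mat F i i = r (β k) * (β' k).mat F j j) {f : FreeStar F (ZMod 2)}
    (hf : f ∈ multilinear F (ZMod 2) n) :
    evM F (extend β) f i i = (∏ k, r (β k)) * evM F (extend β') f j j := by
  refine evM_relation hk (fun σ => ?_) hf
  rw [prod_mat_diag, prod_mat_diag, List.map_ofFn, List.map_ofFn, List.prod_ofFn,
    List.prod_ofFn, ← Equiv.prod_comp σ fun k => r (β k), ← Finset.prod_mul_distrib]
  exact Finset.prod_congr rfl fun k _ => h _

section

variable {n : ℕ} {f : FreeStar F (ZMod 2)}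

theorem evM_zero_zero (hf : f ∈ multilinear F (ZMod 2) n)
    (H : ∀ (k : Slot) (β : Fin n → Bas), k.Good β → evM F (extend β) f k.row k.col = 0)
    (β : Fin n → Bas) : evM F (extend β) f 0 0 = 0 := by
  by_cases hw : ∑ k, (β k).wt = 0
  · rw [evM_diag (β' := fun i => (β i).clearH) (j := 0) (r := fun _ => 1)
      (fun i => (kind_clearH _).symm) (fun k => ?_) hf]
    · have hg : diag.Good fun i => (β i).clearH := by
        have hw' : ∀ i, (β i).wt = 0 := fun i => by
          simpa using (Finset.sum_eq_zero_iff.1 hw) i (Finset.mem_univ i)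
        constructor
        · exact fun i => (by decide : ∀ b : Bas, b.wt = 0 →
          b.clearH = one ∨ b.clearH ∈ ({d} : Finset Bas) ∨ b.clearH ∈ ({c} : Finset Bas)) _ (hw' i)
        · rw [Finset.card_eq_zero, Finset.filter_eq_empty_iff]
          exact fun i _ => (by decide : ∀ b : Bas, b.wt = 0 →
            b.clearH ∉ ({c} : Finset Bas)) _ (hw' i)
      exact mul_eq_zero_of_right _ (H diag _ hg)
    · cases β k <;> simp [mat, clearH]
  · exact evM_eq_zero_of_wt hf (by simpa using hw)

theorem evM_diag_eq_zero (hf : f ∈ multilinear F (ZMod 2) n)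
    (H : ∀ (k : Slot) (β : Fin n → Bas), k.Good β → evM F (extend β) f k.row k.col = 0)
    (β : Fin n → Bas) (i : Fin 3) : evM F (extend β) f i i = 0 := by
  -- The basis elements of weight 0 have entry 1 at (0,0) and the others have zero diagonal, so any
  -- diagonal entry is a multiple of the (0,0) one.
  rw [evM_diag (β' := β) (j := 0) (r := fun b => b.mat F i i) (fun _ => rfl) (fun k => ?_) hf,
    evM_zero_zero hf H, mul_zero]
  cases β k <;> fin_cases i <;> simp [mat]

theorem good_upper_of_wt {β : Fin n → Bas} (hw : ∑ k, (β k).wt = 1) : upper.Good β := by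
  rw [sum_wt] at hw
  refine ⟨fun i => ?_, by omega⟩
  have hc : (Finset.univ.filter fun i => β i ∈ ({c} : Finset Bas)).card = 0 := by omega
  rw [Finset.card_eq_zero, Finset.filter_eq_empty_iff] at hc
  have := @hc i (Finset.mem_univ i)
  revert this
  cases β i <;> simp

theorem evM_zero_one (hf : f ∈ multilinear F (ZMod 2) n)
    (H : ∀ (k : Slot) (β : Fin n → Bas), k.Good β → evM F (extend β) f k.row k.col = 0)
    (β : Fin n → Bas) : evM F (extend β) f 0 1 = 0 := by
  by_cases hw : ∑ k, (β k).wt = 1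
  · exact H upper β (good_upper_of_wt hw)
  · exact evM_eq_zero_of_wt hf (by simpa using hw)

theorem evM_one_two (hf : f ∈ multilinear F (ZMod 2) n)
    (H : ∀ (k : Slot) (β : Fin n → Bas), k.Good β → evM F (extend β) f k.row k.col = 0)
    (β : Fin n → Bas) : evM F (extend β) f 1 2 = 0 := by
  by_cases hw : ∑ k, (β k).wt = 1
  · by_cases hd : ∃ i, β i = d
    · exact H lower β ⟨good_upper_of_wt hw, hd⟩
    · rw [evM_relation (β' := β) (i' := 0) (j' := 1) (r := ∏ k, (β k).ratio F) (fun _ => rfl)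
        (fun σ => ?_) hf, evM_zero_one hf H, mul_zero]
      rw [prod_mat_ratio, List.map_ofFn, List.prod_ofFn, ← Equiv.prod_comp σ fun k => (β k).ratio F]
      · rfl
      · intro hmem
        obtain ⟨k, hk⟩ := List.mem_ofFn.1 hmem
        exact hd ⟨_, hk⟩
  · refine evM_eq_zero_of_wt hf ?_
    simp only [Fin.val_one, Fin.val_two]
    omega

theorem evM_zero_two (hf : f ∈ multilinear F (ZMod 2) n)
    (H : ∀ (k : Slot) (β : Fin n → Bas), k.Good β → evM F (extend β) f k.row k.col = 0)
    (β : Fin n → Bas) : evM F (extend β) f 0 2 = 0 := by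
  by_cases hw : ∑ k, (β k).wt = 2
  swap
  · exact evM_eq_zero_of_wt hf (by simpa using hw)
  have hw' := sum_wt β
  rw [hw] at hw'
  rcases Nat.eq_zero_or_pos (Finset.univ.filter fun i => β i ∈ ({c} : Finset Bas)).card with
    hc | hc
  · refine H double β ⟨fun i => ?_, by omega⟩
    rw [Finset.card_eq_zero, Finset.filter_eq_empty_iff] at hc
    have := @hc i (Finset.mem_univ i)
    revert this
    cases β i <;> simp
  -- Weight two with a `c` present: it is the only `c`, there are no odd terms, and each `h` may be
  -- replaced by `one`.
  have hz : (Finset.univ.filter fun i => β i ∈ ({p, m} : Finset Bas)).card = 0 := by omega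
  have hc : (Finset.univ.filter fun i => β i ∈ ({c} : Finset Bas)).card = 1 := by omega
  rw [Finset.card_eq_zero, Finset.filter_eq_empty_iff] at hz
  have hz' : ∀ i, β i ≠ p ∧ β i ≠ m := fun i => by
    have := @hz i (Finset.mem_univ i)
    simpa using this
  rw [evM_relation (β' := fun i => (β i).clearH) (i' := 0) (j' := 2) (r := 1)
    (fun i => (kind_clearH _).symm) (fun σ => ?_) hf]
  · rw [one_mul]
    by_cases hd : ∃ i, β i = d
    · refine H corner _ ⟨⟨fun i => ?_, ?_⟩, hd.imp fun i hi => by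
          change (β i).clearH = d
          rw [hi]; rfl⟩
      · exact (by decide : ∀ b : Bas, b ≠ p ∧ b ≠ m →
          b.clearH = one ∨ b.clearH ∈ ({d} : Finset Bas) ∨ b.clearH ∈ ({c} : Finset Bas)) _ (hz' i)
      · rw [← hc]
        congr 1
        exact Finset.filter_congr fun i _ => (by decide : ∀ b : Bas,
          b.clearH ∈ ({c} : Finset Bas) ↔ b ∈ ({c} : Finset Bas)) (β i)
    -- Without a `d`, every ordering of the word has (0,2) entry 1, just as the word of identities
    -- has (0,0) entry 1. Since `c` and `one` have the same kind, this is a diagonal functional.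
    · rw [evM_relation (β' := fun _ => one) (i' := 0) (j' := 0) (r := 1) (fun i => ?_)
        (fun σ => ?_) hf, evM_zero_zero hf H, mul_zero]
      · exact (by decide : ∀ b : Bas, b ≠ p ∧ b ≠ m → b ≠ d → b.clearH.kind = one.kind) _
          (hz' i) (not_exists.1 hd i)
      · rw [prod_mat_corner, prod_mat_diag]
        · rw [one_mul, List.map_ofFn]
          refine (List.prod_eq_one fun x hx => ?_).symm
          obtain ⟨k, rfl⟩ := List.mem_ofFn.1 hx
          simp [mat]
        · intro b hb
          obtain ⟨k, rfl⟩ := List.mem_ofFn.1 hb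
          exact (by decide : ∀ b : Bas, b ≠ p ∧ b ≠ m → b ≠ d →
            b.clearH = one ∨ b.clearH = c) _ (hz' (σ k)) (not_exists.1 hd (σ k))
        · rw [List.map_ofFn, List.sum_ofFn, ← hw, ← Equiv.sum_comp σ fun k => (β k).wt]
          exact Finset.sum_congr rfl fun k _ =>
            (by decide : ∀ b : Bas, b.clearH.wt = b.wt) (β (σ k))
  · rw [prod_mat_clearH, one_mul, List.map_ofFn]
    · rfl
    · intro b hb
      obtain ⟨k, rfl⟩ := List.mem_ofFn.1 hb
      exact hz' _

/-- A multilinear polynomial which is killed by all functionals is an identity. -/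
theorem mem_identities_of_good [CharZero F] (hf : f ∈ multilinear F (ZMod 2) n)
    (H : ∀ (k : Slot) (β : Fin n → Bas), k.Good β → evM F (extend β) f k.row k.col = 0) :
    f ∈ identities (reflection3 F) := by
  refine mem_identities_of_evM hf fun β => ?_
  ext i j
  have h0 := evM_diag_eq_zero hf H β 0
  have h1 := evM_diag_eq_zero hf H β 1
  have h2 := evM_diag_eq_zero hf H β 2
  have h01 := evM_zero_one hf H β
  have h12 := evM_one_two hf H β
  have h02 := evM_zero_two hf H β
  rcases lt_or_ge j i with hij | hij
  · exact evM_apply_of_lt _ _ hij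
  · fin_cases i <;> fin_cases j <;> first | assumption | exact absurd hij (by decide)

end

/-! ### Spans of words -/

section WordSpan

variable {F : Type*} [Field F] {A : Type*} [Ring A] [Algebra F A] {ι κ : Type*}

/-- The span of the products of the `v x` over all words whose multiset of labels is `s`. -/
def wordSpan (F : Type*) [Field F] {A : Type*} [Ring A] [Algebra F A] {ι κ : Type*}
    (v : ι → A) (π : ι → κ) (s : Multiset κ) : Submodule F A :=
  Submodule.span F {f | ∃ l : List ι, (↑(l.map π) : Multiset κ) = s ∧ f = (l.map v).prod}

theorem one_mem_wordSpan (v : ι → A) (π : ι → κ) : 1 ∈ wordSpan F v π 0 :=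
  Submodule.subset_span ⟨[], rfl, by simp⟩

theorem mem_wordSpan_singleton (v : ι → A) (π : ι → κ) (x : ι) :
    v x ∈ wordSpan F v π {π x} :=
  Submodule.subset_span ⟨[x], rfl, by simp⟩

theorem mul_mem_wordSpan {v : ι → A} {π : ι → κ} {s t : Multiset κ} {f g : A}
    (hf : f ∈ wordSpan F v π s) (hg : g ∈ wordSpan F v π t) :
    f * g ∈ wordSpan F v π (s + t) := by
  have := Submodule.mul_mem_mul hf hg
  rw [wordSpan, wordSpan, Submodule.span_mul_span] at this
  refine Submodule.span_mono ?_ this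
  rintro _ ⟨_, ⟨l, rfl, rfl⟩, _, ⟨l', rfl, rfl⟩, rfl⟩
  exact ⟨l ++ l', by simp, by simp⟩

theorem commutator_mem_wordSpan {v : ι → A} {π : ι → κ} {s t : Multiset κ} {f g : A}
    (hf : f ∈ wordSpan F v π s) (hg : g ∈ wordSpan F v π t) :
    f * g - g * f ∈ wordSpan F v π (s + t) :=
  Submodule.sub_mem _ (mul_mem_wordSpan hf hg) (add_comm s t ▸ mul_mem_wordSpan hg hf)

theorem map_eq_zero_of_mem_wordSpan {B : Type*} [Ring B] [Algebra F B] {v : ι → A} {π : ι → κ}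
    {s : Multiset κ} (φ : A →ₐ[F] B) {k : κ} (hk : k ∈ s) (hφ : ∀ x, π x = k → φ (v x) = 0)
    {f : A} (hf : f ∈ wordSpan F v π s) : φ f = 0 := by
  induction hf using Submodule.span_induction with
  | mem f hf =>
    obtain ⟨l, rfl, rfl⟩ := hf
    obtain ⟨x, hx, hxk⟩ := List.mem_map.1 (Multiset.mem_coe.1 hk)
    rw [map_list_prod]
    exact List.prod_eq_zero (hφ x hxk ▸ List.mem_map_of_mem (List.mem_map_of_mem hx))
  | zero => exact map_zero φ
  | add f g _ _ hf hg => rw [map_add, hf, hg, add_zero]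
  | smul c f _ hf => rw [map_smul, hf, smul_zero]

end WordSpan

variable {F : Type*} [Field F]

/-- The span of the monomials with the given indices. -/
abbrev multihom (F : Type*) [Field F] (s : Multiset ℕ) : Submodule F (FreeStar F (ZMod 2)) :=
  wordSpan F (FreeAlgebra.ι F) (Prod.fst : ℕ × ZMod 2 × Bool → ℕ) s

/-- The letter `y_i^±` or `z_i^±` of the same kind as the `i`-th term of `b`. -/
def lt (F : Type*) [Field F] (b : ℕ → Bas) (i : ℕ) : FreeStar F (ZMod 2) :=
  letter F (b i).kind i

/-- The span of the words in the letters determined by `b`. -/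
abbrev words (F : Type*) [Field F] (b : ℕ → Bas) (s : Multiset ℕ) :
    Submodule F (FreeStar F (ZMod 2)) :=
  wordSpan F (lt F b) id s

theorem words_le_multihom (b : ℕ → Bas) (s : Multiset ℕ) : words F b s ≤ multihom F s := by
  refine Submodule.span_le.2 ?_
  rintro _ ⟨l, rfl, rfl⟩
  induction l with
  | nil => exact one_mem_wordSpan _ _
  | cons i l ih =>
    rw [List.map_cons, List.map_cons, List.prod_cons, ← Multiset.cons_coe,
      ← Multiset.singleton_add]
    refine mul_mem_wordSpan ?_ ih
    exact Submodule.add_mem _ (mem_wordSpan_singleton _ _ (i, (b i).kind.1, false))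
      (Submodule.smul_mem _ _ (mem_wordSpan_singleton _ _ (i, (b i).kind.1, true)))

theorem multilinear_le_multihom (n : ℕ) :
    multilinear F (ZMod 2) n ≤ multihom F (Multiset.range n) := by
  refine Submodule.span_le.2 ?_
  rintro _ ⟨⟨σ, g, δ⟩, rfl⟩
  refine Submodule.subset_span
    ⟨List.ofFn fun k => ((σ k : ℕ), g k, δ k), ?_, by rw [List.map_ofFn]; rfl⟩
  rw [List.map_ofFn, Multiset.range, Multiset.coe_eq_coe]
  refine (σ.ofFn_comp_perm fun i : Fin n => (i : ℕ)).trans (List.Perm.of_eq ?_)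
  rw [List.ofFn_eq_map, List.map_coe_finRange_eq_range]

theorem multihom_le_multilinear (n : ℕ) :
    multihom F (Multiset.range n) ≤ multilinear F (ZMod 2) n := by
  refine Submodule.span_le.2 ?_
  rintro _ ⟨l, hl, rfl⟩
  rw [Multiset.range, Multiset.coe_eq_coe] at hl
  have hlen : l.length = n := by simpa using hl.length_eq
  subst hlen
  have hlt : ∀ k : Fin l.length, (l.get k).1 < l.length := fun k => by
    have : (l.get k).1 ∈ List.range l.length :=
      hl.subset (List.mem_map_of_mem (List.get_mem l k))
    simpa using this
  have hinj : Function.Injective fun k : Fin l.length => (⟨(l.get k).1, hlt k⟩ : Fin l.length) := by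
    intro k k' hkk
    have hnd : (l.map Prod.fst).Nodup := hl.nodup_iff.2 List.nodup_range
    have := Fin.mk.inj_iff.1 hkk
    have := (List.nodup_iff_injective_get.1 hnd)
      (a₁ := ⟨k, by simp⟩) (a₂ := ⟨k', by simp⟩) (by simpa using this)
    exact Fin.ext (by simpa using this)
  refine Submodule.subset_span ⟨⟨Equiv.ofBijective _ (Finite.injective_iff_bijective.1 hinj),
    fun k => (l.get k).2.1, fun k => (l.get k).2.2⟩, ?_⟩
  change (List.ofFn fun k => FreeAlgebra.ι F (l.get k)).prod = _
  congr 1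
  conv_rhs => rw [← List.ofFn_get l, List.map_ofFn]
  rfl

theorem evM_eq_zero_of_kind [CharZero F] {b b' : ℕ → Bas} {s : Multiset ℕ} {i : ℕ} (hi : i ∈ s)
    (hk : (b' i).kind ≠ (b i).kind) {f : FreeStar F (ZMod 2)} (hf : f ∈ words F b s) :
    evM F b' f = 0 := by
  refine map_eq_zero_of_mem_wordSpan _ hi (fun j hj => ?_) hf
  obtain rfl : j = i := hj
  rw [lt, evM_letter, if_neg hk]

theorem evM_lt [CharZero F] (b : ℕ → Bas) (i : ℕ) : evM F b (lt F b i) = (b i).mat F := by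
  rw [lt, evM_letter, if_pos rfl]

/-! ### Proper polynomials -/

/-- The left-normed commutator `[w, l₁, …, l_k]`. -/
def bracket {A : Type*} [Ring A] (w : A) (l : List A) : A :=
  l.foldl (fun w v => w * v - v * w) w

theorem map_bracket {A B : Type*} [Ring A] [Ring B] [Algebra F A] [Algebra F B] (φ : A →ₐ[F] B)
    (w : A) (l : List A) : φ (bracket w l) = bracket (φ w) (l.map φ) := by
  induction l generalizing w with
  | nil => rfl
  | cons a l ih => exact (ih _).trans (by rw [map_sub, map_mul, map_mul]; rfl)

/-- Commutators do not see scalar shifts of their later entries. -/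
theorem map_bracket_congr {A B : Type*} [Ring A] [Ring B] [Algebra F A] [Algebra F B]
    {φ ψ : A →ₐ[F] B} {w : A} {l : List A} (hw : φ w = ψ w)
    (hl : ∀ v ∈ l, ∃ c : F, φ v = ψ v + algebraMap F B c) :
    φ (bracket w l) = ψ (bracket w l) := by
  induction l generalizing w with
  | nil => exact hw
  | cons a l ih =>
    refine ih ?_ fun v hv => hl v (List.mem_cons_of_mem _ hv)
    obtain ⟨c, hc⟩ := hl a List.mem_cons_self
    rw [map_sub, map_mul, map_mul, map_sub, map_mul, map_mul, hw, hc, mul_add, add_mul,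
      Algebra.commutes c (ψ w)]
    abel

theorem map_orderedProd_congr {B : Type*} [Ring B] [Algebra F B]
    {φ ψ : FreeStar F (ZMod 2) →ₐ[F] B} {v : ℕ → FreeStar F (ZMod 2)}
    (hv : ∀ i, φ (v i) = ψ (v i)) (b : ℕ) (q : ℕ → ℕ) :
    φ (orderedProd F v b q) = ψ (orderedProd F v b q) := by
  rw [orderedProd, map_list_prod, map_list_prod, List.map_map, List.map_map]
  congr 2
  funext i
  simp only [Function.comp_apply, map_pow, hv]

/-- Proper polynomials do not distinguish evaluations which differ by scalars on the `y_i^+`. -/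
theorem map_eq_of_mem_proper {B : Type*} [Ring B] [Algebra F B]
    {φ ψ : FreeStar F (ZMod 2) →ₐ[F] B}
    (h : ∀ v ∈ letters F, ∃ c : F, φ v = ψ v + algebraMap F B c)
    (hy : ∀ i, φ (yMinus F i) = ψ (yMinus F i)) (hzp : ∀ i, φ (zPlus F i) = ψ (zPlus F i))
    (hzm : ∀ i, φ (zMinus F i) = ψ (zMinus F i)) {f : FreeStar F (ZMod 2)} (hf : f ∈ proper F) :
    φ f = ψ f := by
  induction hf using Submodule.span_induction with
  | mem f hf =>
    obtain ⟨b, c, d, q, r, t, us, hus, rfl⟩ := hf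
    have : φ us.prod = ψ us.prod := by
      rw [map_list_prod, map_list_prod]
      congr 1
      refine List.map_congr_left fun u hu => ?_
      obtain ⟨a, ha, b, hb, l, hl, rfl⟩ := hus u hu
      refine map_bracket_congr ?_ fun v hv => h v (hl v hv)
      obtain ⟨c, hc⟩ := h a ha
      obtain ⟨c', hc'⟩ := h b hb
      rw [map_sub, map_mul, map_mul, map_sub, map_mul, map_mul, hc, hc', add_mul, mul_add, mul_add,
        add_mul, mul_add, mul_add, Algebra.commutes c (ψ b), Algebra.commutes c' (ψ a),
        Algebra.commutes c (algebraMap F B c')]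
      abel
    rw [map_mul, map_mul, map_mul, map_mul, map_mul, map_mul, this,
      map_orderedProd_congr hy, map_orderedProd_congr hzp, map_orderedProd_congr hzm]
  | zero => rw [map_zero, map_zero]
  | add f g _ _ hf hg => rw [map_add, map_add, hf, hg]
  | smul c f _ hf => rw [map_smul, map_smul, hf]

/-- Replacing the values at index `i` by 0 changes only y_i^+, and that by the scalar 1, which a
proper polynomial cannot detect. After the replacement each monomial has a zero factor. -/
theorem evM_eq_zero_of_proper [CharZero F] {β : ℕ → Bas} {s : Multiset ℕ} {i : ℕ} (hi : i ∈ s)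
    (hβ : β i = one) {f : FreeStar F (ZMod 2)} (hf : f ∈ proper F) (hs : f ∈ multihom F s) :
    evM F β f = 0 := by
  set ψ : FreeStar F (ZMod 2) →ₐ[F] Matrix (Fin 3) (Fin 3) F :=
    (UT F 3).val.comp (eval (reflection3 F) (Function.update (basSubst F β) i 0)) with hψ
  have hX : ∀ g δ, ψ (X F i g δ) = 0 := by
    intro g δ
    rw [hψ, AlgHom.comp_apply, eval_X, Function.update_self]
    cases δ <;> simp
  have hX' : ∀ j g δ, j ≠ i → ψ (X F j g δ) = evM F β (X F j g δ) := by
    intro j g δ hj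
    rw [hψ, AlgHom.comp_apply, eval_X, Function.update_of_ne hj, evM, AlgHom.comp_apply, eval_X]
  have hl : ∀ k j, evM F β (letter F k j) =
      ψ (letter F k j) + if j = i ∧ k = one.kind then 1 else 0 := by
    intro k j
    by_cases hj : j = i
    · subst hj
      rw [evM_letter, hβ, letter, map_add, map_smul, hX, hX, smul_zero, add_zero, zero_add]
      simp [mat, eq_comm]
    · rw [if_neg fun h => hj h.1, add_zero, letter, map_add, map_add, map_smul, map_smul,
        hX' _ _ _ hj, hX' _ _ _ hj]
  have hl' : ∀ k j, k ≠ one.kind → evM F β (letter F k j) = ψ (letter F k j) := by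
    intro k j hk
    rw [hl, if_neg fun h => hk h.2, add_zero]
  have hlc : ∀ k j, ∃ c : F, evM F β (letter F k j) =
      ψ (letter F k j) + algebraMap F (Matrix (Fin 3) (Fin 3) F) c := by
    intro k j
    refine ⟨if j = i ∧ k = one.kind then 1 else 0, ?_⟩
    rw [hl]
    split_ifs <;> simp
  have key : evM F β f = ψ f := by
    refine map_eq_of_mem_proper ?_ ?_ ?_ ?_ hf
    · rintro v (((⟨j, rfl⟩ | ⟨j, rfl⟩) | ⟨j, rfl⟩) | ⟨j, rfl⟩)
      · rw [yPlus_eq]; exact hlc _ _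
      · rw [yMinus_eq]; exact hlc _ _
      · rw [zPlus_eq]; exact hlc _ _
      · rw [zMinus_eq]; exact hlc _ _
    · intro j; rw [yMinus_eq]; exact hl' _ _ (by decide)
    · intro j; rw [zPlus_eq]; exact hl' _ _ (by decide)
    · intro j; rw [zMinus_eq]; exact hl' _ _ (by decide)
  rw [key]
  refine map_eq_zero_of_mem_wordSpan _ hi ?_ hs
  rintro ⟨j, g, δ⟩ rfl
  exact hX g δ

/-! ### Dual polynomials -/

theorem orderedProd_succ (v : ℕ → FreeStar F (ZMod 2)) (n : ℕ) (q : ℕ → ℕ) :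
    orderedProd F v (n + 1) q = orderedProd F v n q * v n ^ q n := by
  rw [orderedProd, List.range_succ, List.map_append, List.prod_append]
  simp [orderedProd]

theorem orderedProd_congr (v : ℕ → FreeStar F (ZMod 2)) {n : ℕ} {q q' : ℕ → ℕ}
    (h : ∀ i < n, q i = q' i) : orderedProd F v n q = orderedProd F v n q' := by
  induction n with
  | zero => rfl
  | succ n ih =>
    rw [orderedProd_succ, orderedProd_succ, ih fun i hi => h i (by omega), h n (by omega)]

theorem orderedProd_zero (v : ℕ → FreeStar F (ZMod 2)) (n : ℕ) :
    orderedProd F v n (fun _ => 0) = 1 := by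
  induction n with
  | zero => rfl
  | succ n ih => rw [orderedProd_succ, ih, pow_zero, one_mul]

theorem orderedProd_single (v : ℕ → FreeStar F (ZMod 2)) {n i : ℕ} (hi : i < n) :
    orderedProd F v n (fun k => if k = i then 1 else 0) = v i := by
  induction n with
  | zero => omega
  | succ n ih =>
    rw [orderedProd_succ]
    rcases Nat.lt_succ_iff_lt_or_eq.1 hi with h | rfl
    · rw [ih h, if_neg h.ne', pow_zero, mul_one]
    · rw [if_pos rfl, pow_one, orderedProd_congr v (q' := fun _ => 0) fun k hk => if_neg hk.ne,
        orderedProd_zero, one_mul]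

theorem orderedProd_pair (v : ℕ → FreeStar F (ZMod 2)) {i j : ℕ} (hij : i < j) :
    orderedProd F v (j + 1) (fun k => if k = i ∨ k = j then 1 else 0) = v i * v j := by
  rw [orderedProd_succ, if_pos (Or.inr rfl), pow_one,
    orderedProd_congr v (q' := fun k => if k = i then 1 else 0) fun k hk => by
      simp [hk.ne], orderedProd_single v hij]

theorem map_orderedProd {B : Type*} [Ring B] [Algebra F B] (φ : FreeStar F (ZMod 2) →ₐ[F] B)
    {v : ℕ → FreeStar F (ZMod 2)} {n : ℕ} {q : ℕ → ℕ} {T : B}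
    (h : ∀ i < n, q i ≠ 0 → φ (v i) = T) :
    φ (orderedProd F v n q) = T ^ ∑ i ∈ Finset.range n, q i := by
  induction n with
  | zero => simp [orderedProd]
  | succ n ih =>
    rw [orderedProd_succ, map_mul, ih fun i hi => h i (by omega), Finset.sum_range_succ, pow_add,
      map_pow]
    by_cases hq : q n = 0
    · rw [hq, pow_zero, pow_zero]
    · rw [h n (by omega) hq]

/-- The ordered product of the `v i` with `i < n` and `P i`. -/
def select (v : ℕ → FreeStar F (ZMod 2)) (n : ℕ) (P : ℕ → Prop) [DecidablePred P] :
    FreeStar F (ZMod 2) :=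
  orderedProd F v n fun i => if P i then 1 else 0

theorem select_mem_words {v : ℕ → FreeStar F (ZMod 2)} {n : ℕ} {P : ℕ → Prop} [DecidablePred P]
    {b : ℕ → Bas} (h : ∀ i < n, P i → v i = lt F b i) :
    select v n P ∈ words F b ((Multiset.range n).filter P) := by
  induction n with
  | zero => exact one_mem_wordSpan _ _
  | succ n ih =>
    rw [select, orderedProd_succ, Multiset.range_succ, ← Multiset.singleton_add,
      add_comm, Multiset.filter_add]
    refine mul_mem_wordSpan (ih fun i hi => h i (by omega)) ?_
    by_cases hP : P n
    · rw [if_pos hP, pow_one, h n (by omega) hP, Multiset.filter_singleton, if_pos hP]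
      exact mem_wordSpan_singleton _ _ n
    · rw [if_neg hP, pow_zero, Multiset.filter_singleton, if_neg hP]
      exact one_mem_wordSpan _ _

theorem bracket_nil {A : Type*} [Ring A] (w : A) : bracket w [] = w := rfl

theorem bracket_mem_words {b : ℕ → Bas} {s : Multiset ℕ} {w : FreeStar F (ZMod 2)}
    (hw : w ∈ words F b s) (l : List ℕ) :
    bracket w (l.map (lt F b)) ∈ words F b (s + ↑l) := by
  induction l generalizing w s with
  | nil => exact (add_zero s).symm ▸ hw
  | cons i l ih =>
    rw [← Multiset.cons_coe, ← Multiset.singleton_add, ← add_assoc]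
    exact ih (commutator_mem_wordSpan hw (mem_wordSpan_singleton _ id i))

theorem bracket_mem_commutators (b : ℕ → Bas) (i : ℕ) {l : List ℕ} (hl : l ≠ []) :
    bracket (lt F b i) (l.map (lt F b)) ∈ commutators F := by
  obtain ⟨j, l, rfl⟩ := List.exists_cons_of_ne_nil hl
  refine ⟨_, letter_mem_letters _ i, _, letter_mem_letters _ j, l.map (lt F b), ?_, rfl⟩
  intro v hv
  obtain ⟨k, -, rfl⟩ := List.mem_map.1 hv
  exact letter_mem_letters _ k

/-- The ordered products of odd variables. -/
def oddProds (F : Type*) [Field F] : Set (FreeStar F (ZMod 2)) :=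
  {w | ∃ (c d : ℕ) (r t : ℕ → ℕ), w = orderedProd F (zPlus F) c r * orderedProd F (zMinus F) d t}

theorem one_mem_oddProds : 1 ∈ oddProds F := ⟨0, 0, 0, 0, by simp [orderedProd]⟩

theorem lt_mem_oddProds {b : ℕ → Bas} {i : ℕ} (hi : b i = p ∨ b i = m) :
    lt F b i ∈ oddProds F := by
  rcases hi with hi | hi
  · refine ⟨i + 1, 0, fun k => if k = i then 1 else 0, 0, ?_⟩
    rw [orderedProd_single _ (Nat.lt_succ_self i), zPlus_eq, lt, hi]
    simp [orderedProd, kind, deg, skew]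
  · refine ⟨0, i + 1, 0, fun k => if k = i then 1 else 0, ?_⟩
    rw [orderedProd_single _ (Nat.lt_succ_self i), zMinus_eq, lt, hi]
    simp [orderedProd, kind, deg, skew]

/-- The generators of Γ require z^+ before z^- and increasing indices among letters of the same
symmetry; one of the two orders always complies. -/
theorem lt_mul_lt_mem_oddProds {b : ℕ → Bas} {i j : ℕ} (hij : i ≠ j) (hi : b i = p ∨ b i = m)
    (hj : b j = p ∨ b j = m) :
    lt F b i * lt F b j ∈ oddProds F ∨ lt F b j * lt F b i ∈ oddProds F := by
  have hpp : ∀ i j, i < j → b i = p → b j = p → lt F b i * lt F b j ∈ oddProds F := by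
    intro i j hij hi hj
    refine ⟨j + 1, 0, fun k => if k = i ∨ k = j then 1 else 0, 0, ?_⟩
    rw [orderedProd_pair _ hij, zPlus_eq, zPlus_eq, lt, lt, hi, hj]
    simp [orderedProd, kind, deg, skew]
  have hmm : ∀ i j, i < j → b i = m → b j = m → lt F b i * lt F b j ∈ oddProds F := by
    intro i j hij hi hj
    refine ⟨0, j + 1, 0, fun k => if k = i ∨ k = j then 1 else 0, ?_⟩
    rw [orderedProd_pair _ hij, zMinus_eq, zMinus_eq, lt, lt, hi, hj]
    simp [orderedProd, kind, deg, skew]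
  have hpm : ∀ i j, b i = p → b j = m → lt F b i * lt F b j ∈ oddProds F := by
    intro i j hi hj
    refine ⟨i + 1, j + 1, fun k => if k = i then 1 else 0, fun k => if k = j then 1 else 0, ?_⟩
    rw [orderedProd_single _ (Nat.lt_succ_self i), orderedProd_single _ (Nat.lt_succ_self j),
      zPlus_eq, zMinus_eq, lt, lt, hi, hj]
    simp [kind, deg, skew]
  rcases hi with hi | hi <;> rcases hj with hj | hj
  · exact hij.lt_or_gt.imp (hpp i j · hi hj) (hpp j i · hj hi)
  · exact .inl (hpm i j hi hj)
  · exact .inr (hpm j i hj hi)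
  · exact hij.lt_or_gt.imp (hmm i j · hi hj) (hmm j i · hj hi)

theorem select_mul_mem_proper {n : ℕ} {P : ℕ → Prop} [DecidablePred P] {w : FreeStar F (ZMod 2)}
    (hw : w ∈ oddProds F) {us : List (FreeStar F (ZMod 2))} (hus : ∀ u ∈ us, u ∈ commutators F) :
    select (yMinus F) n P * w * us.prod ∈ proper F := by
  obtain ⟨c, d, r, t, rfl⟩ := hw
  exact Submodule.subset_span ⟨n, c, d, _, r, t, us, hus, by
    rw [select, mul_assoc _ _ (orderedProd F (zMinus F) d t)]⟩

/-- Bracketing with `h` sends (x, y) to (-2x, 2y), and bracketing with `d` sends it to (-x, -y). -/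
theorem bracket_mat [CharZero F] {l : List Bas} (hl : ∀ b ∈ l, b = h ∨ b = d) {x y : F}
    (hx : x ≠ 0) (hy : y ≠ 0) : ∃ x' y' : F, x' ≠ 0 ∧ y' ≠ 0 ∧
      bracket !![0, x, 0; 0, 0, y; 0, 0, 0] (l.map (mat F)) =
        !![0, x', 0; 0, 0, y'; 0, 0, 0] := by
  induction l generalizing x y with
  | nil => exact ⟨x, y, hx, hy, rfl⟩
  | cons b l ih =>
    have hl' := fun b hb => hl b (List.mem_cons_of_mem _ hb)
    rcases hl b List.mem_cons_self with rfl | rfl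
    · obtain ⟨x', y', hx', hy', h⟩ := ih hl' (x := -2 * x) (y := 2 * y) (by simpa) (by simpa)
      refine ⟨x', y', hx', hy', Eq.trans ?_ h⟩
      rw [List.map_cons]
      change bracket (_ * _ - _ * _) _ = _
      congr 1
      ext i j
      rw [Matrix.sub_apply, mat, Matrix.mul_diagonal, Matrix.diagonal_mul]
      fin_cases i <;> fin_cases j <;> simp <;> ring
    · obtain ⟨x', y', hx', hy', h⟩ := ih hl' (x := -x) (y := -y) (by simpa) (by simpa)
      refine ⟨x', y', hx', hy', Eq.trans ?_ h⟩
      rw [List.map_cons]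
      change bracket (_ * _ - _ * _) _ = _
      congr 1
      ext i j
      rw [Matrix.sub_apply, mat, Matrix.mul_diagonal, Matrix.diagonal_mul]
      fin_cases i <;> fin_cases j <;> simp

theorem evM_bracket [CharZero F] {b : ℕ → Bas} {i : ℕ} (hi : b i = p ∨ b i = m) {l : List ℕ}
    (hl : ∀ k ∈ l, b k = h ∨ b k = d) : ∃ x y : F, x ≠ 0 ∧ y ≠ 0 ∧
      evM F b (bracket (lt F b i) (l.map (lt F b))) = !![0, x, 0; 0, 0, y; 0, 0, 0] := by
  have hmap : (l.map (lt F b)).map (evM F b) = (l.map b).map (mat F) := by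
    rw [List.map_map, List.map_map]
    exact List.map_congr_left fun k _ => evM_lt b k
  have hl' : ∀ e ∈ l.map b, e = h ∨ e = d := by
    intro e hc
    obtain ⟨k, hk, rfl⟩ := List.mem_map.1 hc
    exact hl k hk
  rw [map_bracket, evM_lt, hmap]
  rcases hi with hi | hi
  · rw [hi]
    exact bracket_mat hl' one_ne_zero one_ne_zero
  · rw [hi]
    exact bracket_mat hl' one_ne_zero (neg_ne_zero.2 one_ne_zero)

/-- This is the power `d`^q, q being the number of selected letters. The (0,0) entry is always 1,
while the middle one is 0^q, which dies as soon as a letter is selected. -/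
theorem evM_select [CharZero F] {b : ℕ → Bas} {n : ℕ} {P : ℕ → Prop} [DecidablePred P]
    (hP : ∀ i < n, P i → b i = d) :
    ∃ q : ℕ, ((∃ i < n, P i) → q ≠ 0) ∧ evM F b (select (yMinus F) n P) =
      Matrix.diagonal ![1, 0 ^ q, (-1) ^ q] := by
  refine ⟨∑ i ∈ Finset.range n, if P i then 1 else 0, ?_, ?_⟩
  · rintro ⟨i, hi, hPi⟩ h0
    have := Finset.sum_eq_zero_iff.1 h0 i (Finset.mem_range.2 hi)
    simp [hPi] at this
  · rw [select, map_orderedProd (T := d.mat F), mat, Matrix.diagonal_pow]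
    · congr 1
      funext i
      obtain rfl | rfl | rfl : i = 0 ∨ i = 1 ∨ i = 2 := by omega
      all_goals simp
    · intro i hi hq
      have hPi : P i := by
        by_contra h
        simp [h] at hq
      rw [yMinus_eq, evM_letter, hP i hi hPi]
      rfl

theorem count_range (n i : ℕ) : (Multiset.range n).count i = if i < n then 1 else 0 := by
  rw [Multiset.count_eq_of_nodup (Multiset.nodup_range n)]
  simp

theorem yMinus_eq_lt {b : ℕ → Bas} {i : ℕ} (hi : b i = d) : yMinus F i = lt F b i := by
  rw [yMinus_eq, lt, hi]
  rfl

/-- The properties of a proper polynomial which isolates the functional given by `k` and `b`. -/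
def IsDual (k : Slot) (n : ℕ) (b : ℕ → Bas) (g : FreeStar F (ZMod 2)) : Prop :=
  g ∈ proper F ∧ g ∈ words F b ((Multiset.range n).filter fun i => b i ≠ one) ∧
    evM F b g k.row k.col ≠ 0 ∧ (k = Slot.upper → (∃ i < n, b i = d) → evM F b g 1 2 = 0)

section

variable [CharZero F] {n : ℕ} {b : ℕ → Bas}

theorem exists_isDual_diag (hb : ∀ i < n, b i = one ∨ b i = d) :
    ∃ g : FreeStar F (ZMod 2), IsDual diag n b g := by
  obtain ⟨q, -, hq⟩ := evM_select (F := F) (b := b) (n := n) (P := fun i => b i = d)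
    fun _ _ h => h
  refine ⟨select (yMinus F) n fun i => b i = d, ?_, ?_, ?_, by simp⟩
  · simpa using select_mul_mem_proper (F := F) (n := n) (P := fun i => b i = d)
      one_mem_oddProds (us := []) (by simp)
  · rw [Multiset.filter_congr (q := fun i => b i = d)]
    · exact select_mem_words fun i _ hi => yMinus_eq_lt hi
    · intro i hi
      rcases hb i (Multiset.mem_range.1 hi) with h | h <;> simp [h]
  · rw [hq]
    simp [row, col]

/-- The y^+ at the position of `c` must sit inside a commutator, so one y^- is spent on it: [`d`,
`c`] = 2 e₁₃. The remaining y^- stand on the left. -/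
theorem exists_isDual_corner {i₀ j₀ : ℕ} (hi₀ : i₀ < n) (hj₀ : j₀ < n) (hc : b i₀ = c)
    (hd : b j₀ = d) (hb : ∀ i < n, i ≠ i₀ → b i = one ∨ b i = d) :
    ∃ g : FreeStar F (ZMod 2), IsDual corner n b g := by
  obtain ⟨q, -, hq⟩ := evM_select (F := F) (b := b) (n := n) (P := fun i => b i = d ∧ i ≠ j₀)
    fun _ _ h => h.1
  refine ⟨select (yMinus F) n (fun i => b i = d ∧ i ≠ j₀) *
    bracket (lt F b j₀) ([i₀].map (lt F b)), ?_, ?_, ?_, by simp⟩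
  · simpa using select_mul_mem_proper (F := F) (n := n) (P := fun i => b i = d ∧ i ≠ j₀)
      one_mem_oddProds (us := [bracket (lt F b j₀) ([i₀].map (lt F b))])
      (by simpa using bracket_mem_commutators b j₀ (l := [i₀]) (by simp))
  · have : (Multiset.range n).filter (fun i => b i ≠ one) =
        (Multiset.range n).filter (fun i => b i = d ∧ i ≠ j₀) + ({j₀} + ↑[i₀]) := by
      ext i
      simp only [Multiset.count_add, Multiset.count_filter, Multiset.count_singleton,
        Multiset.coe_singleton, count_range]
      by_cases hi : i < n
      · by_cases h₁ : i = i₀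
        · subst h₁
          have : i ≠ j₀ := by rintro rfl; simp [hc] at hd
          simp [hc, this, hi]
        · by_cases h₂ : i = j₀
          · subst h₂
            simp [hd, h₁, hi]
          · rcases hb i hi h₁ with h | h <;> simp [h, h₁, h₂, hi]
      · have h₁ : i ≠ i₀ := by omega
        have h₂ : i ≠ j₀ := by omega
        simp [h₁, h₂, hi]
    rw [this]
    exact mul_mem_wordSpan (select_mem_words fun i _ hi => yMinus_eq_lt hi.1)
      (bracket_mem_words (mem_wordSpan_singleton _ id j₀) _)
  · rw [map_mul, hq, map_bracket]
    simp only [List.map_cons, List.map_nil, evM_lt, hc, hd]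
    change (_ * (_ * _ - _ * _) : Matrix (Fin 3) (Fin 3) F) 0 2 ≠ 0
    rw [Matrix.diagonal_mul, Matrix.sub_apply, mat, mat, Matrix.mul_diagonal, Matrix.diagonal_mul]
    change (1 : F) * (1 * 1 - 1 * (-1)) ≠ 0
    norm_num

/-- The y^- stand to the left of the odd letter bracketed with the terms `h`. They keep row 0 and,
if there is any, kill row 1; this separates `upper` from `lower`. -/
theorem exists_isDual_upper {i₀ : ℕ} (hi₀ : i₀ < n) (hz : b i₀ = p ∨ b i₀ = m)
    (hb : ∀ i < n, i ≠ i₀ → b i = one ∨ b i = h ∨ b i = d) :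
    ∃ g : FreeStar F (ZMod 2), IsDual Slot.upper n b g := by
  obtain ⟨q, hq0, hq⟩ := evM_select (F := F) (b := b) (n := n) (P := fun i => b i = d)
    fun _ _ h => h
  set l := (List.range n).filter fun i => b i = h with hl
  obtain ⟨x, y, hx, hy, hxy⟩ := evM_bracket (F := F) hz (l := l) fun k hk => by
    rw [hl, List.mem_filter] at hk
    exact .inl (by simpa using hk.2)
  refine ⟨select (yMinus F) n (fun i => b i = d) * bracket (lt F b i₀) (l.map (lt F b)),
    ?_, ?_, ?_, ?_⟩
  -- With nothing to bracket, the odd letter is not a commutator and must be counted among the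
  -- ordered odd factors.
  · by_cases hl0 : l = []
    · rw [hl0, List.map_nil, bracket_nil]
      simpa using select_mul_mem_proper (F := F) (n := n) (P := fun i => b i = d)
        (lt_mem_oddProds hz) (us := []) (by simp)
    · simpa using select_mul_mem_proper (F := F) (n := n) (P := fun i => b i = d)
        one_mem_oddProds (us := [bracket (lt F b i₀) (l.map (lt F b))])
        (by simpa using bracket_mem_commutators b i₀ hl0)
  · have : (Multiset.range n).filter (fun i => b i ≠ one) =
        (Multiset.range n).filter (fun i => b i = d) + ({i₀} + ↑l) := by
      have hl' : (↑l : Multiset ℕ) = (Multiset.range n).filter fun i => b i = h := by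
        rw [hl, Multiset.range, Multiset.filter_coe]
      rw [hl']
      ext i
      simp only [Multiset.count_add, Multiset.count_filter, Multiset.count_singleton,
        count_range]
      by_cases hi : i < n
      · by_cases h₁ : i = i₀
        · subst h₁
          rcases hz with hz | hz <;> simp [hz, hi]
        · rcases hb i hi h₁ with h | h | h <;> simp [h, h₁, hi]
      · have h₁ : i ≠ i₀ := by omega
        simp [h₁, hi]
    rw [this]
    exact mul_mem_wordSpan (select_mem_words fun i _ hi => yMinus_eq_lt hi)
      (bracket_mem_words (mem_wordSpan_singleton _ id i₀) _)
  · rw [map_mul, hq, hxy]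
    simpa [row, col] using hx
  · intro _ hd
    rw [map_mul, hq, hxy]
    simp [hq0 hd]

/-- Here the terms `d` are bracketed too, so that none stands on the left to kill row 1. The
presence of a `d` makes the commutator a genuine one. -/
theorem exists_isDual_lower {i₀ j₀ : ℕ} (hi₀ : i₀ < n) (hj₀ : j₀ < n)
    (hz : b i₀ = p ∨ b i₀ = m) (hd : b j₀ = d)
    (hb : ∀ i < n, i ≠ i₀ → b i = one ∨ b i = h ∨ b i = d) :
    ∃ g : FreeStar F (ZMod 2), IsDual Slot.lower n b g := by
  set l := (List.range n).filter fun i => b i = h ∨ b i = d with hl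
  obtain ⟨x, y, hx, hy, hxy⟩ := evM_bracket (F := F) hz (l := l) fun k hk => by
    rw [hl, List.mem_filter] at hk
    simpa using hk.2
  have hl0 : l ≠ [] := List.ne_nil_of_mem (a := j₀) (by simp [hl, hj₀, hd])
  refine ⟨bracket (lt F b i₀) (l.map (lt F b)), ?_, ?_, ?_, by simp⟩
  · simpa [select, orderedProd] using select_mul_mem_proper (F := F) (n := 0)
      (P := fun i => b i = d) one_mem_oddProds (us := [bracket (lt F b i₀) (l.map (lt F b))])
      (by simpa using bracket_mem_commutators b i₀ hl0)
  · have : (Multiset.range n).filter (fun i => b i ≠ one) = {i₀} + ↑l := by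
      have hl' : (↑l : Multiset ℕ) = (Multiset.range n).filter fun i => b i = h ∨ b i = d := by
        rw [hl, Multiset.range, Multiset.filter_coe]
      rw [hl']
      ext i
      simp only [Multiset.count_add, Multiset.count_filter, Multiset.count_singleton,
        count_range]
      by_cases hi : i < n
      · by_cases h₁ : i = i₀
        · subst h₁
          rcases hz with hz | hz <;> simp [hz, hi]
        · rcases hb i hi h₁ with h | h | h <;> simp [h, h₁, hi]
      · have h₁ : i ≠ i₀ := by omega
        simp [h₁, hi]
    rw [this]
    exact bracket_mem_words (mem_wordSpan_singleton _ id i₀) _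
  · rw [hxy]
    simpa [row, col] using hy

/-- Entry (0,2) is the (0,1) entry of the first odd letter times the (1,2) entry of the bracket that
starts with the second; both are nonzero. -/
theorem exists_isDual_double {i₀ j₀ : ℕ} (hi₀ : i₀ < n) (hj₀ : j₀ < n) (hij : i₀ ≠ j₀)
    (hzi : b i₀ = p ∨ b i₀ = m) (hzj : b j₀ = p ∨ b j₀ = m)
    (hb : ∀ i < n, i ≠ i₀ → i ≠ j₀ → b i = one ∨ b i = h ∨ b i = d) :
    ∃ g : FreeStar F (ZMod 2), IsDual double n b g := by
  wlog hord : lt F b i₀ * lt F b j₀ ∈ oddProds F generalizing i₀ j₀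
  · exact this hj₀ hi₀ hij.symm hzj hzi (fun i hi h₁ h₂ => hb i hi h₂ h₁)
      ((lt_mul_lt_mem_oddProds hij hzi hzj).resolve_left hord)
  obtain ⟨q, -, hq⟩ := evM_select (F := F) (b := b) (n := n) (P := fun i => b i = d)
    fun _ _ h => h
  set l := (List.range n).filter fun i => b i = h with hl
  obtain ⟨x, y, hx, hy, hxy⟩ := evM_bracket (F := F) hzj (l := l) fun k hk => by
    rw [hl, List.mem_filter] at hk
    exact .inl (by simpa using hk.2)
  refine ⟨select (yMinus F) n (fun i => b i = d) * lt F b i₀ *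
    bracket (lt F b j₀) (l.map (lt F b)), ?_, ?_, ?_, by simp⟩
  · by_cases hl0 : l = []
    · rw [hl0, List.map_nil, bracket_nil]
      simpa [mul_assoc] using select_mul_mem_proper (F := F) (n := n) (P := fun i => b i = d)
        hord (us := []) (by simp)
    · simpa using select_mul_mem_proper (F := F) (n := n) (P := fun i => b i = d)
        (lt_mem_oddProds hzi) (us := [bracket (lt F b j₀) (l.map (lt F b))])
        (by simpa using bracket_mem_commutators b j₀ hl0)
  · have : (Multiset.range n).filter (fun i => b i ≠ one) =
        (Multiset.range n).filter (fun i => b i = d) + {i₀} + ({j₀} + ↑l) := by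
      have hl' : (↑l : Multiset ℕ) = (Multiset.range n).filter fun i => b i = h := by
        rw [hl, Multiset.range, Multiset.filter_coe]
      rw [hl']
      ext i
      simp only [Multiset.count_add, Multiset.count_filter, Multiset.count_singleton,
        count_range]
      by_cases hi : i < n
      · by_cases h₁ : i = i₀
        · subst h₁
          rcases hzi with hz | hz <;> simp [hz, hi, hij]
        · by_cases h₂ : i = j₀
          · subst h₂
            rcases hzj with hz | hz <;> simp [hz, hi, h₁]
          · rcases hb i hi h₁ h₂ with h | h | h <;> simp [h, h₁, h₂, hi]
      · have h₁ : i ≠ i₀ := by omega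
        have h₂ : i ≠ j₀ := by omega
        simp [h₁, h₂, hi]
    rw [this]
    exact mul_mem_wordSpan (mul_mem_wordSpan
      (select_mem_words fun i _ hi => yMinus_eq_lt hi) (mem_wordSpan_singleton _ id i₀))
      (bracket_mem_words (mem_wordSpan_singleton _ id j₀) _)
  · rw [map_mul, map_mul, hq, hxy, evM_lt]
    rcases hzi with hz | hz <;>
      simpa [row, col, hz, mat, Matrix.mul_apply, Fin.sum_univ_three, Matrix.diagonal_apply]
        using hy

end

/-! ### Independence of the functionals -/

theorem card_filter_eq_zero_of_marked {n : ℕ} {Y X Z : Finset Bas} {k : ℕ} {β : Fin n → Bas}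
    (hβ : Marked Y X k β) (h1 : one ∉ Z) (hX : Disjoint X Z) (hY : Disjoint Y Z) :
    (Finset.univ.filter fun i => β i ∈ Z).card = 0 := by
  rw [Finset.card_eq_zero, Finset.filter_eq_empty_iff]
  intro i _ hi
  rcases hβ.1 i with h | h | h
  · exact h1 (h ▸ hi)
  · exact Finset.disjoint_left.1 hX h hi
  · exact Finset.disjoint_left.1 hY h hi

/-- The numbers of terms `c` and of odd terms in the sequences belonging to a functional. -/
def Slot.counts : Slot → ℕ × ℕ
  | .diag => (0, 0)
  | .corner => (1, 0)
  | .upper | .lower => (0, 1)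
  | .double => (0, 2)

theorem Slot.Good.counts_eq {n : ℕ} {k : Slot} {β : Fin n → Bas} (hβ : k.Good β) :
    ((Finset.univ.filter fun i => β i ∈ ({c} : Finset Bas)).card,
      (Finset.univ.filter fun i => β i ∈ ({p, m} : Finset Bas)).card) = k.counts := by
  have h₁ : ∀ {k}, Marked {c} {d} k β →
      (Finset.univ.filter fun i => β i ∈ ({p, m} : Finset Bas)).card = 0 := fun h =>
    card_filter_eq_zero_of_marked h (by decide) (by decide) (by decide)
  have h₂ : ∀ {k}, Marked {p, m} {h, d} k β →
      (Finset.univ.filter fun i => β i ∈ ({c} : Finset Bas)).card = 0 := fun h =>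
    card_filter_eq_zero_of_marked h (by decide) (by decide) (by decide)
  cases k
  · exact Prod.ext hβ.2 (h₁ hβ)
  · exact Prod.ext hβ.1.2 (h₁ hβ.1)
  · exact Prod.ext (h₂ hβ) hβ.2
  · exact Prod.ext (h₂ hβ.1) hβ.1.2
  · exact Prod.ext (h₂ hβ) hβ.2

/-- A good sequence containing `c` has no odd terms, one containing `h` has at least one, and kinds
detect odd terms. -/
theorem ne_h_of_good {n : ℕ} {k k' : Slot} {β β' : Fin n → Bas} (hβ : k.Good β)
    (hβ' : k'.Good β') (hk : ∀ i, (β' i).kind = (β i).kind) {i : Fin n} (hi : β i = c) :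
    β' i ≠ h := by
  intro hi'
  have hM : ∃ r, Marked {c} {d} r β := by
    cases k
    · exact ⟨_, hβ⟩
    · exact ⟨_, hβ.1⟩
    · rcases hβ.1 i with h | h | h <;> simp [hi] at h
    · rcases hβ.1.1 i with h | h | h <;> simp [hi] at h
    · rcases hβ.1 i with h | h | h <;> simp [hi] at h
  have hM' : ∃ r ≠ 0, Marked {p, m} {h, d} r β' := by
    cases k'
    · rcases hβ'.1 i with h | h | h <;> simp [hi'] at h
    · rcases hβ'.1.1 i with h | h | h <;> simp [hi'] at h
    · exact ⟨_, one_ne_zero, hβ'⟩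
    · exact ⟨_, one_ne_zero, hβ'.1⟩
    · exact ⟨_, two_ne_zero, hβ'⟩
  obtain ⟨r, hM⟩ := hM
  obtain ⟨r', hr', hM'⟩ := hM'
  rw [← hM'.2, Finset.card_ne_zero] at hr'
  obtain ⟨j, hj⟩ := hr'
  have hj' := (Finset.mem_filter.1 hj).2
  exact (by decide : ∀ e e' : Bas, e' ∈ ({p, m} : Finset Bas) → e'.kind = e.kind →
    ¬(e = one ∨ e ∈ ({d} : Finset Bas) ∨ e ∈ ({c} : Finset Bas))) _ _ hj' (hk j) (hM.1 j)

/-- Kinds and the positions of `one` leave only `c` and `h` to be told apart. -/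
theorem good_ext {n : ℕ} {k k' : Slot} {β β' : Fin n → Bas} (hβ : k.Good β) (hβ' : k'.Good β')
    (hk : ∀ i, (β' i).kind = (β i).kind) (h1 : ∀ i, β i = one ↔ β' i = one) : β = β' := by
  funext i
  have h₁ := ne_h_of_good hβ hβ' hk (i := i)
  have h₂ := ne_h_of_good hβ' hβ (fun i => (hk i).symm) (i := i)
  exact (by decide : ∀ e e' : Bas, e'.kind = e.kind → (e = one ↔ e' = one) →
    (e = c → e' ≠ h) → (e' = c → e ≠ h) → e = e') _ _ (hk i) (h1 i) h₁ h₂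

theorem exists_isDual [CharZero F] {n : ℕ} {k : Slot} {β : Fin n → Bas} (hβ : k.Good β) :
    ∃ g : FreeStar F (ZMod 2), IsDual k n (extend β) g := by
  have hex : ∀ i (hi : i < n), extend β i = β ⟨i, hi⟩ := fun i hi => dif_pos hi
  have hcorner : ∀ {r}, Marked {c} {d} r β → ∀ i (hi : i < n), β ⟨i, hi⟩ ∉ ({c} : Finset Bas) →
      extend β i = one ∨ extend β i = d := by
    intro r hM i hi hic
    rw [hex i hi]
    rcases hM.1 ⟨i, hi⟩ with h | h | h
    · exact .inl h
    · exact .inr (Finset.mem_singleton.1 h)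
    · exact absurd h hic
  have hupper : ∀ {r}, Marked {p, m} {h, d} r β → ∀ i (hi : i < n),
      β ⟨i, hi⟩ ∉ ({p, m} : Finset Bas) →
      extend β i = one ∨ extend β i = h ∨ extend β i = d := by
    intro r hM i hi hic
    rw [hex i hi]
    rcases hM.1 ⟨i, hi⟩ with h | h | h
    · exact .inl h
    · exact .inr (by simpa using h)
    · exact absurd h hic
  cases k
  · refine exists_isDual_diag fun i hi => hcorner hβ i hi fun hic => ?_
    have h0 := hβ.2
    rw [Finset.card_eq_zero, Finset.filter_eq_empty_iff] at h0
    exact h0 (Finset.mem_univ _) hic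
  · obtain ⟨hM, j, hj⟩ := hβ
    obtain ⟨i, hi⟩ := Finset.card_eq_one.1 hM.2
    have hmem : ∀ j, β j ∈ ({c} : Finset Bas) ↔ j = i := fun j => by
      simpa using Finset.ext_iff.1 hi j
    refine exists_isDual_corner i.2 j.2 (by simpa using (hmem i).2 rfl) (by simpa using hj)
      fun l hl hli => hcorner hM l hl fun hc => hli ?_
    exact congrArg Fin.val ((hmem _).1 hc)
  · obtain ⟨i, hi⟩ := Finset.card_eq_one.1 hβ.2
    have hmem : ∀ j, β j ∈ ({p, m} : Finset Bas) ↔ j = i := fun j => by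
      simpa using Finset.ext_iff.1 hi j
    refine exists_isDual_upper i.2 (by simpa using (hmem i).2 rfl)
      fun l hl hli => hupper hβ l hl fun hc => hli ?_
    exact congrArg Fin.val ((hmem _).1 hc)
  · obtain ⟨hM, j, hj⟩ := hβ
    obtain ⟨i, hi⟩ := Finset.card_eq_one.1 hM.2
    have hmem : ∀ j, β j ∈ ({p, m} : Finset Bas) ↔ j = i := fun j => by
      simpa using Finset.ext_iff.1 hi j
    refine exists_isDual_lower i.2 j.2 (by simpa using (hmem i).2 rfl) (by simpa using hj)
      fun l hl hli => hupper hM l hl fun hc => hli ?_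
    exact congrArg Fin.val ((hmem _).1 hc)
  · obtain ⟨i, j, hij, hi⟩ := Finset.card_eq_two.1 hβ.2
    have hmem : ∀ l, β l ∈ ({p, m} : Finset Bas) ↔ l = i ∨ l = j := fun l => by
      simpa using Finset.ext_iff.1 hi l
    refine exists_isDual_double i.2 j.2 (fun h => hij (Fin.ext h))
      (by simpa using (hmem i).2 (.inl rfl)) (by simpa using (hmem j).2 (.inr rfl))
      fun l hl hli hlj => hupper hβ l hl fun hc => ?_
    exact ((hmem _).1 hc).elim (fun h => hli (congrArg Fin.val h))
      fun h => hlj (congrArg Fin.val h)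

/-- A multilinear polynomial, proper if possible, which isolates a functional. -/
theorem exists_dual [CharZero F] {n : ℕ} {k : Slot} {β : Fin n → Bas} (hβ : k.Good β) :
    ∃ f ∈ words F (extend β) (Multiset.range n), ((∀ i, β i ≠ one) → f ∈ proper F) ∧
      (∀ β' : Fin n → Bas, (∃ i, β i ≠ one ∧ β' i = one) → evM F (extend β') f = 0) ∧
      evM F (extend β) f k.row k.col ≠ 0 ∧
      (k = Slot.upper → (∃ i, β i = d) → evM F (extend β) f 1 2 = 0) := by
  obtain ⟨g, hg, hw, hne, hz⟩ := exists_isDual (F := F) hβ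
  have hone : evM F (extend β) (select (yPlus F) n fun i => extend β i = one) = 1 := by
    rw [select, map_orderedProd (T := 1), one_pow]
    intro i _ hi
    have : extend β i = one := by
      by_contra h
      simp [h] at hi
    rw [yPlus_eq, evM_letter, this]
    rfl
  -- The positions of `one` are filled by y_i^+, whose product evaluates to the identity at `β`. If
  -- there are none, this factor is 1 and the polynomial stays proper.
  refine ⟨g * select (yPlus F) n fun i => extend β i = one, ?_, ?_, ?_, ?_, ?_⟩
  · have := mul_mem_wordSpan hw (select_mem_words (F := F) (v := yPlus F) (n := n) (b := extend β)
      (P := fun i => extend β i = one) fun i _ hi => by rw [yPlus_eq, lt, hi]; rfl)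
    rwa [add_comm, Multiset.filter_add_not] at this
  · intro h
    rw [select, orderedProd_congr _ (q' := fun _ => 0), orderedProd_zero, mul_one]
    · exact hg
    · intro i hi
      rw [extend, dif_pos hi, if_neg (h _)]
  · rintro β' ⟨i, hi, hi'⟩
    rw [map_mul, evM_eq_zero_of_proper (s := (Multiset.range n).filter fun i => extend β i ≠ one)
      (i := i) (by simpa using hi) (by simpa using hi') hg (words_le_multihom _ _ hw), zero_mul]
  · rwa [map_mul, hone, mul_one]
  · rintro hk ⟨i, hi⟩
    rw [map_mul, hone, mul_one]
    exact hz hk ⟨i, i.2, by simpa using hi⟩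

/-- By induction on the rank every unit vector lies in the range of the joint map on `V`: the image
of the test vector for `i` is a nonzero multiple of the i-th unit vector plus unit vectors of
smaller rank. So the quotient is the whole coordinate space. -/
theorem finrank_quotient_of_triangular {E ι : Type*} [AddCommGroup E] [Module F E] [Fintype ι]
    (V T : Submodule F E) (Ψ : ι → E →ₗ[F] F) (hT : ∀ f ∈ V, f ∈ T ↔ ∀ i, Ψ i f = 0)
    (rank : ι → ℕ)
    (h : ∀ i, ∃ f ∈ V, Ψ i f ≠ 0 ∧ ∀ j ≠ i, rank i ≤ rank j → Ψ j f = 0) :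
    Module.finrank F (V ⧸ T.submoduleOf V) = Fintype.card ι := by
  classical
  set Φ : V →ₗ[F] (ι → F) := (LinearMap.pi Ψ).domRestrict V with hΦ
  have hker : T.submoduleOf V = LinearMap.ker Φ := by
    ext f
    rw [LinearMap.mem_ker, funext_iff]
    exact hT f f.2
  have hsingle : ∀ (r : ℕ) (i : ι), rank i = r → Pi.single i (1 : F) ∈ LinearMap.range Φ := by
    intro r
    induction r using Nat.strong_induction_on with
    | _ r ih =>
      rintro i rfl
      obtain ⟨f, hf, hne, hz⟩ := h i
      have hsum : (Ψ i f) • (Pi.single i 1 : ι → F) = Φ ⟨f, hf⟩ -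
          ∑ j ∈ Finset.univ.filter fun j => rank j < rank i,
            (Ψ j f) • (Pi.single j 1 : ι → F) := by
        funext j
        have hΦj : Φ ⟨f, hf⟩ j = Ψ j f := rfl
        rw [Pi.sub_apply, hΦj, Finset.sum_apply, Pi.smul_apply, smul_eq_mul]
        simp only [Pi.smul_apply, smul_eq_mul, Pi.single_apply, mul_ite, mul_one, mul_zero]
        rw [Finset.sum_ite_eq]
        by_cases hj : j = i
        · subst hj
          simp
        · by_cases hr : rank j < rank i
          · simp [hj, hr]
          · simp [hj, hr, hz j hj (not_lt.1 hr)]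
      have hmem : (Ψ i f) • (Pi.single i 1 : ι → F) ∈ LinearMap.range Φ := by
        rw [hsum]
        refine Submodule.sub_mem _ (LinearMap.mem_range_self _ _) (Submodule.sum_mem _ fun j hj =>
          Submodule.smul_mem _ _ (ih _ (Finset.mem_filter.1 hj).2 j rfl))
      simpa [smul_smul, hne] using Submodule.smul_mem _ (Ψ i f)⁻¹ hmem
  have hsurj : Function.Surjective Φ := by
    rw [← LinearMap.range_eq_top, eq_top_iff]
    intro x _
    rw [pi_eq_sum_univ' x]
    exact Submodule.sum_mem _ fun i _ => Submodule.smul_mem _ _ (hsingle _ i rfl)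
  rw [hker, (Φ.quotKerEquivOfSurjective hsurj).finrank_eq, Module.finrank_fintype_fun_eq_card]

/-- The functionals belonging to sequences with the property `R`. -/
abbrev Functionals (n : ℕ) (R : (Fin n → Bas) → Prop) : Type :=
  {x : Slot × (Fin n → Bas) // x.1.Good x.2 ∧ R x.2}

/-- The value of a functional at a polynomial. -/
def functional (F : Type*) [Field F] {n : ℕ} (x : Slot × (Fin n → Bas)) :
    FreeStar F (ZMod 2) →ₗ[F] F :=
  Matrix.entryLinearMap F F x.1.row x.1.col ∘ₗ (evM F (extend x.2)).toLinearMap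

theorem functional_apply {n : ℕ} (x : Slot × (Fin n → Bas)) (f : FreeStar F (ZMod 2)) :
    functional F x f = evM F (extend x.2) f x.1.row x.1.col := rfl

-- One statement covers both codimensions: `R` holds always for P_n, and says that no term is `one`
-- for Γ_n.
open scoped Classical in
theorem dimModIdentities_eq_card [CharZero F] {n : ℕ} {R : (Fin n → Bas) → Prop}
    {V : Submodule F (FreeStar F (ZMod 2))} (hV : V ≤ multilinear F (ZMod 2) n)
    (hzero : ∀ f ∈ V, ∀ β, ¬R β → evM F (extend β) f = 0)
    (hmem : ∀ β, R β → ∀ f ∈ multilinear F (ZMod 2) n,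
      ((∀ i, β i ≠ one) → f ∈ proper F) → f ∈ V) :
    dimModIdentities (reflection3 F) V = Nat.card (Functionals n R) := by
  rw [Nat.card_eq_fintype_card]
  refine finrank_quotient_of_triangular V _ (fun x : Functionals n R => functional F x.1)
    (fun f hf => ⟨fun hT x => ?_, fun H => ?_⟩)
    -- Doubling lets the number of `one`s dominate. The extra unit puts `lower` after `upper` at the
    -- same sequence, because the dual of `upper` vanishes under `lower` but not conversely.
    (fun x => 2 * (Finset.univ.filter fun i => x.1.2 i = one).card +
      if x.1.1 = Slot.lower then 1 else 0) ?_
  · rw [functional_apply, evM_eq_zero_of_mem hT]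
    rfl
  · refine mem_identities_of_good (hV hf) fun k β hβ => ?_
    by_cases hR : R β
    · exact H ⟨(k, β), hβ, hR⟩
    · rw [hzero f hf β hR]
      rfl
  · rintro ⟨⟨k, β⟩, hβ, hR⟩
    obtain ⟨f, hw, hp, hone, hne, hlow⟩ := exists_dual (F := F) hβ
    refine ⟨f, hmem β hR f (multihom_le_multilinear n (words_le_multihom _ _ hw)) hp, hne, ?_⟩
    rintro ⟨⟨k', β'⟩, hβ', hR'⟩ hx hrank
    rw [functional_apply]
    dsimp only at hβ hβ' hrank ⊢
    by_contra hne'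
    have hkind : ∀ i, (β' i).kind = (β i).kind := by
      intro i
      by_contra hk
      refine hne' ?_
      rw [evM_eq_zero_of_kind (i := i) (by simp) (by simpa using hk) hw]
      rfl
    have hsub : (Finset.univ.filter fun i => β' i = one) ⊆
        Finset.univ.filter fun i => β i = one := by
      intro i hi
      rw [Finset.mem_filter] at hi ⊢
      refine ⟨hi.1, ?_⟩
      by_contra h
      refine hne' ?_
      rw [hone β' ⟨i, h, hi.2⟩]
      rfl
    have hle := Finset.card_le_card hsub
    have heq := Finset.eq_of_subset_of_card_le hsub (by split_ifs at hrank <;> omega)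
    have hββ : β = β' := good_ext hβ hβ' hkind fun i => by
      have := Finset.ext_iff.1 heq i
      simpa using this.symm
    subst hββ
    have hkk : k ≠ k' := fun h => hx (by subst h; rfl)
    have hcounts := hβ.counts_eq.symm.trans hβ'.counts_eq
    have hkk' : k = Slot.upper ∧ k' = Slot.lower := by
      revert hrank hcounts hkk
      generalize (Finset.univ.filter fun i => β i = one).card = N
      cases k <;> cases k' <;> simp [counts]
    obtain ⟨rfl, rfl⟩ := hkk'
    exact hne' (hlow rfl hβ'.2)

theorem codim_eq_card [CharZero F] (n : ℕ) :
    codim (reflection3 F) n = Nat.card (Functionals n fun _ => True) :=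
  dimModIdentities_eq_card le_rfl (fun _ _ _ h => absurd trivial h) fun _ _ _ hf _ => hf

theorem properCodim_eq_card [CharZero F] (n : ℕ) :
    properCodim (reflection3 F) n = Nat.card (Functionals n fun β => ∀ i, β i ≠ one) := by
  refine dimModIdentities_eq_card (F := F) inf_le_right (fun f hf β hβ => ?_)
    fun β hβ f hf hp => ⟨hp hβ, hf⟩
  push Not at hβ
  obtain ⟨i, hi⟩ := hβ
  exact evM_eq_zero_of_proper (i := i) (s := Multiset.range n) (by simp) (by simpa using hi) hf.1
    (multilinear_le_multihom n hf.2)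

/-! ### Counting the functionals -/

/-- The positions at which a sequence is not `one`. -/
def supp {n : ℕ} (β : Fin n → Bas) : Finset (Fin n) := Finset.univ.filter fun i => β i ≠ one

-- Once the k positions with values in `Y` are chosen inside `S`, the remaining choices form a
-- product of finite sets.
open scoped Classical in
theorem card_marked {n : ℕ} (S : Finset (Fin n)) {Y X : Finset Bas} (hY : one ∉ Y) (hX : one ∉ X)
    (hXY : Disjoint X Y) (k : ℕ) :
    (Finset.univ.filter fun β : Fin n → Bas => Marked Y X k β ∧ supp β = S).card =
      S.card.choose k * (Y.card ^ k * X.card ^ (S.card - k)) := by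
  have hmaps : ∀ β ∈ Finset.univ.filter fun β : Fin n → Bas => Marked Y X k β ∧ supp β = S,
      (Finset.univ.filter fun i => β i ∈ Y) ∈ S.powersetCard k := by
    intro β hβ
    obtain ⟨-, hM, rfl⟩ := Finset.mem_filter.1 hβ
    refine Finset.mem_powersetCard.2 ⟨fun i hi => ?_, hM.2⟩
    exact Finset.mem_filter.2 ⟨Finset.mem_univ i, fun h => hY (h ▸ (Finset.mem_filter.1 hi).2)⟩
  rw [Finset.card_eq_sum_card_fiberwise hmaps, ← Finset.card_powersetCard k S,
    ← smul_eq_mul, ← Finset.sum_const]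
  refine Finset.sum_congr rfl fun T hT => ?_
  obtain ⟨hTS, hTk⟩ := Finset.mem_powersetCard.1 hT
  have hfib : ((Finset.univ.filter fun β : Fin n → Bas => Marked Y X k β ∧ supp β = S).filter
      fun β => (Finset.univ.filter fun i => β i ∈ Y) = T) =
      Fintype.piFinset fun i => if i ∈ S then (if i ∈ T then Y else X) else {one} := by
    ext β
    rw [Fintype.mem_piFinset, Finset.mem_filter, Finset.mem_filter]
    constructor
    · rintro ⟨⟨-, hM, rfl⟩, rfl⟩ i
      by_cases h1 : β i = one
      · simp [supp, h1]
      · by_cases hi : β i ∈ Y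
        · simp [supp, h1, hi]
        · have := (hM.1 i).resolve_left h1
          simpa [supp, h1, hi] using this
    · intro hβ
      have hY' : (Finset.univ.filter fun i => β i ∈ Y) = T := by
        ext i
        have := hβ i
        rw [Finset.mem_filter]
        by_cases hT : i ∈ T
        · rw [if_pos (hTS hT), if_pos hT] at this
          simp [hT, this]
        · by_cases hS : i ∈ S
          · rw [if_pos hS, if_neg hT] at this
            simp [hT, Finset.disjoint_left.1 hXY this]
          · rw [if_neg hS, Finset.mem_singleton] at this
            simp [hT, this, hY]
      refine ⟨⟨Finset.mem_univ _, ⟨fun i => ?_, by rw [hY', hTk]⟩, ?_⟩, hY'⟩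
      · have := hβ i
        split_ifs at this
        · exact .inr (.inr this)
        · exact .inr (.inl this)
        · exact .inl (Finset.mem_singleton.1 this)
      · ext i
        have := hβ i
        rw [supp, Finset.mem_filter]
        by_cases hS : i ∈ S
        · have h1 : β i ≠ one := by
            rintro h
            rw [h, if_pos hS] at this
            split_ifs at this
            · exact hY this
            · exact hX this
          simp [hS, h1]
        · rw [if_neg hS, Finset.mem_singleton] at this
          simp [hS, this]
  rw [hfib, Fintype.card_piFinset]
  have : ∀ i, (if i ∈ S then (if i ∈ T then Y else X) else {one}).card =
      if i ∈ S then (if i ∈ T then Y.card else X.card) else 1 := by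
    intro i
    split_ifs <;> simp
  simp only [this]
  rw [Finset.prod_ite, Finset.prod_const_one, mul_one, Finset.filter_univ_mem, Finset.prod_ite,
    Finset.prod_const, Finset.prod_const]
  have h₁ : S.filter (fun i => i ∈ T) = T := by
    rw [Finset.filter_mem_eq_inter, Finset.inter_eq_right.2 hTS]
  have h₂ : (S.filter fun i => i ∉ T).card = S.card - k := by
    rw [Finset.filter_notMem_eq_sdiff, Finset.card_sdiff_of_subset hTS, hTk]
  rw [h₁, h₂, hTk]

/-- The number of functionals of each kind with a support of given size. -/
def Slot.number : Slot → ℕ → ℕ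
  | .diag, _ => 1
  | .corner, s => if s = 1 then 0 else s
  | .upper, s => s * 2 ^ s
  | .lower, s => s * (2 ^ s - 2)
  | .double, s => s.choose 2 * 2 ^ s

theorem marked_not_d {n : ℕ} {Y X : Finset Bas} (hd : d ∉ X) (hY : d ∉ Y) {k : ℕ}
    {β : Fin n → Bas} :
    (Marked Y (insert d X) k β ∧ ¬∃ i, β i = d) ↔ Marked Y X k β := by
  constructor
  · rintro ⟨hM, hn⟩
    refine ⟨fun i => ?_, hM.2⟩
    rcases hM.1 i with h | h | h
    · exact .inl h
    · exact .inr (.inl ((Finset.mem_insert.1 h).resolve_left fun h => hn ⟨i, h⟩))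
    · exact .inr (.inr h)
  · intro hM
    refine ⟨⟨fun i => ?_, hM.2⟩, ?_⟩
    · exact (hM.1 i).imp id (Or.imp (Finset.mem_insert_of_mem) id)
    · rintro ⟨i, hi⟩
      rcases hM.1 i with h | h | h
      · rw [hi] at h; cases h
      · exact hd (hi ▸ h)
      · exact hY (hi ▸ h)

-- All marked sequences minus those avoiding `d`, stated additively because natural subtraction
-- truncates.
open scoped Classical in
theorem card_marked_d {n : ℕ} (S : Finset (Fin n)) {Y X X' : Finset Bas}
    (hX' : X' = insert d X) (hY : one ∉ Y)
    (hX : one ∉ X) (hXY : Disjoint X Y) (hd : d ∉ X) (hYd : d ∉ Y) (k : ℕ) :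
    (Finset.univ.filter fun β : Fin n → Bas =>
      (Marked Y X' k β ∧ ∃ i, β i = d) ∧ supp β = S).card +
      S.card.choose k * (Y.card ^ k * X.card ^ (S.card - k)) =
      S.card.choose k * (Y.card ^ k * (X.card + 1) ^ (S.card - k)) := by
  subst hX'
  rw [← card_marked S hY hX hXY, ← Finset.card_insert_of_notMem hd,
    ← card_marked S hY (X := insert d X) (by simpa using hX) (by
      rw [Finset.disjoint_insert_left]; exact ⟨hYd, hXY⟩),
    ← Finset.card_filter_add_card_filter_not (s := Finset.univ.filter fun β : Fin n → Bas =>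
      Marked Y (insert d X) k β ∧ supp β = S) (fun β => ∃ i, β i = d),
    Finset.filter_filter, Finset.filter_filter]
  congr 2
  · ext β
    simp only [Finset.mem_filter]
    tauto
  · ext β
    simp only [Finset.mem_filter, ← marked_not_d hd hYd]
    tauto

open scoped Classical in
theorem card_good {n : ℕ} (k : Slot) (S : Finset (Fin n)) :
    (Finset.univ.filter fun β : Fin n → Bas => k.Good β ∧ supp β = S).card =
      k.number S.card := by
  cases k
  · exact (card_marked S (by decide) (by decide) (by decide) 0).trans (by simp [number])
  · have := card_marked_d S (Y := {c}) (X := ∅) (X' := {d}) (by decide) (by decide)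
      (by decide) (by decide) (by decide)
      (by decide) 1
    simp only [Finset.card_singleton, Finset.card_empty, Nat.choose_one_right, one_pow, one_mul,
      zero_add, mul_one] at this
    have hG : (Finset.univ.filter fun β : Fin n → Bas => Slot.Good .corner β ∧ supp β = S) =
        Finset.univ.filter fun β : Fin n → Bas =>
          (Marked {c} {d} 1 β ∧ ∃ i, β i = d) ∧ supp β = S := by
      ext β
      rw [Finset.mem_filter, Finset.mem_filter]
      rfl
    rw [hG]
    rw [number]
    -- A single position cannot hold both `c` and `d`: for s = 1 the subtracted term 0^(s-1) equals
    -- 1 and cancels the count.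
    split_ifs with h
    · rw [h] at this
      simpa using this
    · rcases Nat.eq_zero_or_pos S.card with h0 | h0
      · rw [h0] at this ⊢
        simpa using this
      · rwa [zero_pow (by omega), mul_zero, add_zero] at this
  · refine (card_marked S (by decide) (by decide) (by decide) 1).trans ?_
    rw [number, Nat.choose_one_right]
    rcases Nat.eq_zero_or_pos S.card with h0 | h0
    · simp [h0]
    · obtain ⟨s, hs⟩ := Nat.exists_eq_add_of_lt h0
      rw [hs]
      simp [pow_succ, mul_comm]
  · have := card_marked_d S (Y := {p, m}) (X := {h}) (X' := {h, d}) (by decide)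
      (by decide) (by decide) (by decide)
      (by decide) (by decide) 1
    have hG : (Finset.univ.filter fun β : Fin n → Bas => Slot.Good .lower β ∧ supp β = S) =
        Finset.univ.filter fun β : Fin n → Bas =>
          (Marked {p, m} {h, d} 1 β ∧ ∃ i, β i = d) ∧ supp β = S := by
      ext β
      rw [Finset.mem_filter, Finset.mem_filter]
      rfl
    rw [hG]
    have : ∀ {N : ℕ}, N + S.card.choose 1 * (({p, m} : Finset Bas).card ^ 1 *
        ({h} : Finset Bas).card ^ (S.card - 1)) = S.card.choose 1 *
        (({p, m} : Finset Bas).card ^ 1 * (({h} : Finset Bas).card + 1) ^ (S.card - 1)) →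
        N = number .lower S.card := by
      intro N hN
      have h2 : ({p, m} : Finset Bas).card = 2 := rfl
      rw [h2, Finset.card_singleton, Nat.choose_one_right, one_pow, pow_one, mul_one] at hN
      rw [number, Nat.mul_sub]
      rcases Nat.eq_zero_or_pos S.card with h0 | h0
      · rw [h0] at hN ⊢
        simpa using hN
      · obtain ⟨s, hs⟩ := Nat.exists_eq_add_of_lt h0
        rw [hs] at hN ⊢
        simp only [zero_add, Nat.add_sub_cancel] at hN ⊢
        rw [pow_succ, mul_comm (2 ^ s) 2]
        simp only [one_add_one_eq_two] at hN
        omega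
    exact this ‹_›
  · refine (card_marked S (by decide) (by decide) (by decide) 2).trans ?_
    rw [number]
    rcases Nat.lt_or_ge S.card 2 with h0 | h0
    · simp [Nat.choose_eq_zero_of_lt h0]
    · obtain ⟨s, hs⟩ := Nat.exists_eq_add_of_le h0
      rw [hs]
      simp [pow_add]

/-- The `Y⁺`-proper codimensions. -/
def properNumber (s : ℕ) : ℕ := ∑ k : Slot, k.number s

theorem properNumber_eq (s : ℕ) : properNumber s =
    1 + (if s = 1 then 0 else s) + s * 2 ^ s + s * (2 ^ s - 2) + s.choose 2 * 2 ^ s := by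
  have : (Finset.univ : Finset Slot) = {.diag, .corner, .upper, .lower, .double} := rfl
  rw [properNumber, this]
  simp [number, add_assoc]

-- Functionals are grouped by support and then by slot; group sizes depend only on the size of the
-- support. Γ_n allows only the full support and P_n all of them, whence the binomial relation
-- between the codimensions.
open scoped Classical in
theorem card_functionals {n : ℕ} (R : (Fin n → Bas) → Prop) (𝒮 : Finset (Finset (Fin n)))
    (h : ∀ β, R β ↔ supp β ∈ 𝒮) :
    Nat.card (Functionals n R) = ∑ S ∈ 𝒮, properNumber S.card := by
  rw [Nat.card_eq_fintype_card, Fintype.card_subtype,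
    Finset.card_eq_sum_card_fiberwise (t := 𝒮) (f := fun x => supp x.2)
    fun x hx => (h x.2).1 (Finset.mem_filter.1 hx).2.2]
  refine Finset.sum_congr rfl fun S hS => ?_
  rw [properNumber, Finset.card_eq_sum_card_fiberwise (t := Finset.univ) (f := Prod.fst)
    fun x _ => Finset.mem_univ _]
  refine Finset.sum_congr rfl fun k _ => ?_
  rw [← card_good k S]
  refine Finset.card_bij' (fun x _ => x.2) (fun β _ => (k, β)) ?_ ?_ ?_ ?_
  · rintro ⟨k', β⟩ hx
    simp only [Finset.mem_filter, Finset.mem_univ, true_and] at hx ⊢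
    obtain ⟨⟨⟨hg, -⟩, hs⟩, rfl⟩ := hx
    exact ⟨hg, hs⟩
  · intro β hβ
    simp only [Finset.mem_filter, Finset.mem_univ, true_and] at hβ ⊢
    exact ⟨⟨⟨hβ.1, (h β).2 (hβ.2 ▸ hS)⟩, hβ.2⟩, trivial⟩
  · rintro ⟨k', β⟩ hx
    rw [← (Finset.mem_filter.1 hx).2]
  · intro β _
    rfl

section

variable (F : Type*) [Field F] [CharZero F]

theorem properCodim_eq (n : ℕ) : properCodim (reflection3 F) n = properNumber n := by
  rw [properCodim_eq_card, card_functionals _ {Finset.univ}]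
  · simp
  · intro β
    rw [Finset.mem_singleton, supp, Finset.filter_eq_self]
    simp

theorem codim_eq (n : ℕ) : codim (reflection3 F) n =
    ∑ i ∈ Finset.range (n + 1), n.choose i * properNumber i := by
  rw [codim_eq_card, card_functionals _ Finset.univ fun β => by simp, ← Finset.powerset_univ,
    Finset.sum_powerset_apply_card]
  simp

end

/-! ### Closed form, bounds and the exponent -/

theorem properNumber_of_ne_one {n : ℕ} (hn : n ≠ 1) :
    properNumber n = 1 + n + 2 * n * (2 ^ n - 1) + n.choose 2 * 2 ^ n := by
  rw [properNumber_eq, if_neg hn]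
  rcases Nat.eq_zero_or_pos n with rfl | h0
  · simp
  · obtain ⟨e, he⟩ : ∃ e, 2 ^ n = e + 2 := Nat.exists_eq_add_of_le' (by
      calc 2 = 2 ^ 1 := rfl
        _ ≤ 2 ^ n := Nat.pow_le_pow_right (by norm_num) h0)
    rw [he, Nat.add_sub_cancel, show e + 2 - 1 = e + 1 by omega]
    ring

theorem two_pow_le_properNumber (n : ℕ) : 2 ^ n ≤ properNumber n := by
  rw [properNumber_eq]
  rcases Nat.eq_zero_or_pos n with rfl | h0
  · simp
  · have : 2 ^ n ≤ n * 2 ^ n := Nat.le_mul_of_pos_left _ h0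
    omega

theorem properNumber_le {i n : ℕ} (hi : i ≤ n) :
    properNumber i ≤ (1 + 2 * n + n.choose 2) * 2 ^ i := by
  -- The contributions of `diag` and `corner` together are at most i + 1, hence fit into one copy of
  -- 2^i.
  have h₁ : i + 1 ≤ 2 ^ i := Nat.lt_two_pow_self
  have h₂ : (if i = 1 then 0 else i) ≤ i := by split_ifs <;> omega
  have h₃ : i * (2 ^ i - 2) ≤ i * 2 ^ i := Nat.mul_le_mul_left _ (Nat.sub_le _ _)
  calc properNumber i ≤ (1 + 2 * i + i.choose 2) * 2 ^ i := by
        rw [properNumber_eq, add_mul, add_mul, one_mul, two_mul, add_mul]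
        omega
    _ ≤ _ := by gcongr

theorem sum_choose_mul_two_pow (n : ℕ) :
    ∑ i ∈ Finset.range (n + 1), n.choose i * 2 ^ i = 3 ^ n := by
  have := add_pow 2 1 n
  rw [show 2 + 1 = 3 from rfl] at this
  rw [this]
  exact Finset.sum_congr rfl fun i _ => by rw [one_pow, mul_one, mul_comm]; rfl

section

variable (F : Type*) [Field F] [CharZero F]

theorem three_pow_le_codim (n : ℕ) : 3 ^ n ≤ codim (reflection3 F) n := by
  rw [codim_eq, ← sum_choose_mul_two_pow]
  exact Finset.sum_le_sum fun i _ => Nat.mul_le_mul_left _ (two_pow_le_properNumber i)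

theorem codim_le (n : ℕ) :
    codim (reflection3 F) n ≤ (1 + 2 * n + n.choose 2) * 3 ^ n := by
  rw [codim_eq, ← sum_choose_mul_two_pow, Finset.mul_sum]
  refine Finset.sum_le_sum fun i hi => ?_
  rw [mul_left_comm]
  exact Nat.mul_le_mul_left _ (properNumber_le (Nat.lt_succ_iff.1 (Finset.mem_range.1 hi)))

/-- The n-th root is squeezed between 3 and 3 n^(2/n). -/
theorem hasExponent_three : HasExponent (reflection3 F) 3 := by
  have hlim : Tendsto (fun n : ℕ => (n : ℝ) ^ ((2 : ℝ) / n) * 3) atTop (𝓝 3) := by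
    have := (tendsto_rpow_div_mul_add 2 1 0 one_ne_zero.symm).comp tendsto_natCast_atTop_atTop
    simpa [Function.comp_def] using this.mul_const (3 : ℝ)
  refine tendsto_of_tendsto_of_tendsto_of_le_of_le' tendsto_const_nhds hlim ?_ ?_
  · filter_upwards [eventually_ge_atTop 1] with n hn
    have h₁ : ((3 : ℝ) ^ n) ≤ codim (reflection3 F) n := by
      exact_mod_cast three_pow_le_codim F n
    calc (3 : ℝ) = ((3 : ℝ) ^ n) ^ ((1 : ℝ) / n) := by
          rw [one_div, Real.pow_rpow_inv_natCast (by norm_num) (by omega)]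
      _ ≤ _ := Real.rpow_le_rpow (by positivity) h₁ (by positivity)
  -- The polynomial factor is at most n² from n = 4 on; this fails for n = 3.
  · filter_upwards [eventually_ge_atTop 4] with n hn
    have hpoly : 1 + 2 * n + n.choose 2 ≤ n ^ 2 := by
      have h2 : 2 * n.choose 2 = n * (n - 1) := by
        rw [Nat.choose_two_right, Nat.mul_div_cancel' (Nat.even_mul_pred_self n).two_dvd]
      obtain ⟨e, rfl⟩ := Nat.exists_eq_add_of_le' hn
      rw [show e + 4 - 1 = e + 3 by omega] at h2
      nlinarith
    have h₁ : (codim (reflection3 F) n : ℝ) ≤ (n : ℝ) ^ 2 * 3 ^ n := by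
      exact_mod_cast (codim_le F n).trans (Nat.mul_le_mul_right _ hpoly)
    calc (codim (reflection3 F) n : ℝ) ^ ((1 : ℝ) / n)
        ≤ ((n : ℝ) ^ 2 * 3 ^ n) ^ ((1 : ℝ) / n) :=
          Real.rpow_le_rpow (by positivity) h₁ (by positivity)
      _ = (n : ℝ) ^ ((2 : ℝ) / n) * 3 := by
          rw [Real.mul_rpow (by positivity) (by positivity)]
          congr 1
          · rw [← Real.rpow_natCast, ← Real.rpow_mul (by positivity)]
            congr 1
            push_cast
            ring
          · rw [one_div, Real.pow_rpow_inv_natCast (by norm_num) (by omega)]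

end

end UTStar

end

open UTStar in
theorem mainTheorem6 (F : Type*) [Field F] [CharZero F] :
    (∀ n : ℕ, n ≠ 1 → properCodim (reflection3 F) n =
      1 + n + 2 * n * (2 ^ n - 1) + n.choose 2 * 2 ^ n) ∧
    properCodim (reflection3 F) 1 = 3 ∧
    (∀ n : ℕ, codim (reflection3 F) n =
      ∑ i ∈ Finset.range (n + 1), n.choose i * properCodim (reflection3 F) i) ∧
    (∀ n : ℕ, 3 ^ n ≤ codim (reflection3 F) n ∧
      codim (reflection3 F) n ≤ (1 + 2 * n + n.choose 2) * 3 ^ n) ∧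
    HasExponent (reflection3 F) 3 := by
  refine ⟨fun n hn => by rw [properCodim_eq, properNumber_of_ne_one hn],
    by rw [properCodim_eq, properNumber_eq]; simp, fun n => ?_,
    fun n => ⟨three_pow_le_codim F n, codim_le F n⟩, hasExponent_three F⟩
  rw [codim_eq]
  exact Finset.sum_congr rfl fun i _ => by rw [properCodim_eq]
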